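/- \textbf{Setting.} There are $m\ge 1$ unrelated machines. An instance consists of a finite set of $n$ jobs; job $j$ has a release time $r_j\ge 0$, a weight $w_j>0$, a processing length $p_j>0$, and rates $\ell_{ij}\ge 0$ on the machines $i$. At each time $t$ a schedule assigns each job $j$ to one machine $\sigma(j,t)$ and gives it processing power $\nu_j(t)\ge 0$ (both measurable in $t$). On machines of speed $s$, $\sum_{j:\sigma(j,t)=i}\nu_j(t)\le s$ for all $i,t$. The completion time $C_j$ is the first $t\ge r_j$ with $\int_{r_j}^{t}\ell_{\sigma(j,u)j}\,\nu_j(u)\,du\ge p_j$ ($C_j=\infty$ if there is none), and the total weighted flow-time is $\sum_j w_j(C_j-r_j)$. Job $j$ is active at time $t$ if $r_j\le t<C_j$. An online algorithm is non-clairvoyant if what it does with the active jobs at time $t$ depends only on the jobs released up to time $t$, with their release times, weights and rates, and on the completions up to time $t$. It is $s$-speed $c$-competitive if on machines of speed $s$ its total weighted flow-time is, on every instance, at most $c$ times the infimum over all schedules on machines of speed $1$. \textbf{SelfishMigrate} with parameters $k\in\mathbb N$, $\theta\ge 0$ on machines of speed $s$. Each machine $i$ keeps the active jobs assigned to it in a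 virtual queue. Let $W(i,t)$ be their total weight, and let $\mathcal W_j(t)$ be the total weight of the jobs ahead of $j$ in the queue of its machine. A job $j$ on machine $i$ gets $$\nu_j(t)=s\cdot\frac{(\mathcal W_j(t)+w_j)^{k+1}-\mathcal W_j(t)^{k+1}}{W(i,t)^{k+1}}$$ and has virtual utility $\phi_j=\ell_{ij}/(\mathcal W_j(t)+w_j)$. A job released at time $t$ joins the tail of the queue of a machine $d$ that maximizes $\ell_{dj}/(W(d,t)+w_j)$. A completed job is deleted from its queue. At every time the jobs perform sequential best response: a job $j$ on machine $i$ for which $\max_{d\ne i}\ell_{dj}/(W(d,t)+w_j)$ is larger than $\phi_j$ and at least $(1+\theta)\phi_j$ moves to the tail of the queue of a maximizing machine, until no job can move. The basic algorithm is $\theta=0$. \textbf{Theorem.} There is an absolute constant $C>0$ such that for every $\epsilon>0$ there are $k\in\mathbb N$ and $\theta>0$, depending only on $\epsilon$, such that for every $m\ge1$: (1) there is a non-clairvoyant online algorithm, all of whose runs are runs of SelfishMigrate with parameters $k$ and $0$ on machines of speed $1+\epsilon$, that is $(1+\epsilon)$-speed $C(1+1/\epsilon^2)$-competitive for minimizing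 total weighted flow-time on $m$ unrelated machines; (2) there is a non-clairvoyant online algorithm, all of whose runs are runs of SelfishMigrate with parameters $k$ and $\theta$ on machines of speed $1+\epsilon$, that is also $(1+\epsilon)$-speed $C(1+1/\epsilon^2)$-competitive, and that on every instance changes the machine of each job, while the job is active, at most $C(1+1/\epsilon)(\log W+\log n)$ times, where $n$ is the number of jobs and $W$ is the ratio of the maximum to the minimum job weight. In particular, for $0<\epsilon\le1$ the competitive ratio is $O(1/\epsilon^2)$ and the number of migrations per job is $O((\log W+\log n)/\epsilon)$. -/

import Mathlib

open Filter Topology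
open scoped ENNReal

namespace UnrelatedMachines

/-- An instance of weighted flow-time scheduling on `m` unrelated machines: a finite set of
jobs (labelled by natural numbers), with release times, weights, processing lengths, and
processing rates `rate i j` of job `j` on machine `i`. A rate may be zero. The data of labels
outside `jobs` are irrelevant. -/
structure Instance (m : ℕ) where
  jobs : Finset ℕ
  release : ℕ → ℝ
  weight : ℕ → ℝ
  size : ℕ → ℝ
  rate : Fin m → ℕ → ℝ
  release_nonneg : ∀ j ∈ jobs, 0 ≤ release j
  weight_pos : ∀ j ∈ jobs, 0 < weight j
  size_pos : ∀ j ∈ jobs, 0 < size j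
  rate_nonneg : ∀ i, ∀ j ∈ jobs, 0 ≤ rate i j

/-- A preemptive, migratory schedule: at each time a job is assigned to one machine and gets
some of the processing power of that machine. -/
structure Schedule (m : ℕ) where
  mach : ℕ → ℝ → Fin m
  power : ℕ → ℝ → ℝ

variable {m : ℕ}

/-- Feasibility on machines of speed `s`: each machine splits processing power at most `s`
among the jobs assigned to it. -/
structure Feasible (s : ℝ) (I : Instance m) (S : Schedule m) : Prop where
  measurable_mach : ∀ j ∈ I.jobs, Measurable (S.mach j)
  measurable_power : ∀ j ∈ I.jobs, Measurable (S.power j)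
  power_nonneg : ∀ j ∈ I.jobs, ∀ t, 0 ≤ S.power j t
  power_sum_le : ∀ i t, ∑ j ∈ I.jobs with S.mach j t = i, S.power j t ≤ s

/-- The amount of job `j` processed between its release and time `t`. In a feasible schedule
the integrand is bounded and measurable. -/
noncomputable def work (I : Instance m) (S : Schedule m) (j : ℕ) (t : ℝ) : ℝ :=
  ∫ u in (I.release j)..t, I.rate (S.mach j u) j * S.power j u

/-- Job `j` is completed by time `t`. -/
def Done (I : Instance m) (S : Schedule m) (j : ℕ) (t : ℝ) : Prop :=
  I.release j ≤ t ∧ I.size j ≤ work I S j t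

/-- Job `j` is active at time `t`: released and not yet completed. -/
def Active (I : Instance m) (S : Schedule m) (j : ℕ) (t : ℝ) : Prop :=
  j ∈ I.jobs ∧ I.release j ≤ t ∧ ¬ Done I S j t

/-- The flow-time `C_j - r_j`, where `C_j` is the first time at which `j` is completed; it is
`∞` if `j` is never completed. -/
noncomputable def flowTime (I : Instance m) (S : Schedule m) (j : ℕ) : ℝ≥0∞ :=
  ⨅ (t : ℝ) (_ : Done I S j t), ENNReal.ofReal (t - I.release j)

/-- The total weighted flow-time. -/
noncomputable def cost (I : Instance m) (S : Schedule m) : ℝ≥0∞ :=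
  ∑ j ∈ I.jobs, ENNReal.ofReal (I.weight j) * flowTime I S j

/-- The offline optimum, on machines of unit speed. -/
noncomputable def opt (I : Instance m) : ℝ≥0∞ :=
  ⨅ (S : Schedule m) (_ : Feasible 1 I S), cost I S

/-- What a non-clairvoyant scheduler has observed up to and including time `t` is the same in
two runs: the same jobs have been released, at the same times, with the same weights and rates,
and they have been completed at the same times. Processing lengths are not observed. -/
def SameHistory (I₁ : Instance m) (S₁ : Schedule m) (I₂ : Instance m) (S₂ : Schedule m)
    (t : ℝ) : Prop :=
  (∀ j, (j ∈ I₁.jobs ∧ I₁.release j ≤ t) ↔ (j ∈ I₂.jobs ∧ I₂.release j ≤ t)) ∧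
  ∀ j ∈ I₁.jobs, I₁.release j ≤ t →
    I₁.release j = I₂.release j ∧ I₁.weight j = I₂.weight j ∧
    (∀ i, I₁.rate i j = I₂.rate i j) ∧
    ∀ u ≤ t, (Done I₁ S₁ j u ↔ Done I₂ S₂ j u)

/-- A non-clairvoyant online algorithm on machines of speed `s`: it produces a feasible
schedule for every instance, and what it does at time `t` with the active jobs is determined by
the history observed up to time `t`. -/
structure IsNonClairvoyant (s : ℝ) (A : Instance m → Schedule m) : Prop where
  feasible : ∀ I, Feasible s I (A I)
  causal : ∀ I₁ I₂ t, SameHistory I₁ (A I₁) I₂ (A I₂) t → ∀ j, Active I₁ (A I₁) j t →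
    (A I₁).mach j t = (A I₂).mach j t ∧ (A I₁).power j t = (A I₂).power j t

/-- `c`-competitiveness against the optimum on machines of unit speed. -/
def IsCompetitive (c : ℝ) (A : Instance m → Schedule m) : Prop :=
  ∀ I, cost I (A I) ≤ ENNReal.ofReal c * opt I

/-- While it is active, job `j` changes its machine at most `B` times: along every finite
nondecreasing sequence of times at which `j` is active, the assigned machine changes at most
`B` times. -/
def MigratesAtMost (I : Instance m) (S : Schedule m) (j : ℕ) (B : ℝ) : Prop :=
  ∀ (N : ℕ) (τ : ℕ → ℝ), Monotone τ → (∀ a ≤ N, Active I S j (τ a)) →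
    (((Finset.range N).filter fun a => S.mach j (τ a) ≠ S.mach j (τ (a + 1))).card : ℝ) ≤ B

/-- The ratio of the maximum job weight to the minimum job weight. -/
noncomputable def weightRatio (I : Instance m) : ℝ :=
  if h : I.jobs.Nonempty then I.jobs.sup' h I.weight / I.jobs.inf' h I.weight else 1

/-! ### The algorithm SelfishMigrate -/

/-- The virtual queues of the machines; the head of each list is the head of the queue. -/
abbrev Queues (m : ℕ) := Fin m → List ℕ

/-- The total weight of a queue. -/
def totalWeight (I : Instance m) (L : List ℕ) : ℝ := (L.map I.weight).sum

/-- The total weight of the jobs ahead of `j` in a queue. -/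
def weightAhead (I : Instance m) (L : List ℕ) (j : ℕ) : ℝ :=
  totalWeight I (L.takeWhile fun j' => j' ≠ j)

/-- The share of `j` in a queue `L` on a machine of speed `s` under weighted ranked processor
sharing with parameter `k`: with `V` the weight ahead of `j`, `w` the weight of `j`, and `T`
the total weight, `s * ((V + w)^(k+1) - V^(k+1)) / T^(k+1)`. -/
noncomputable def share (I : Instance m) (k : ℕ) (s : ℝ) (L : List ℕ) (j : ℕ) : ℝ :=
  s * ((weightAhead I L j + I.weight j) ^ (k + 1) - weightAhead I L j ^ (k + 1)) /
    totalWeight I L ^ (k + 1)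

/-- The virtual utility of job `j` in the queue of machine `i`. -/
noncomputable def utility (I : Instance m) (Q : Queues m) (i : Fin m) (j : ℕ) : ℝ :=
  I.rate i j / (weightAhead I (Q i) j + I.weight j)

/-- The virtual utility that job `j` would get at the tail of the queue of another machine
`d`. -/
noncomputable def joinUtility (I : Instance m) (Q : Queues m) (d : Fin m) (j : ℕ) : ℝ :=
  I.rate d j / (totalWeight I (Q d) + I.weight j)

/-- Append `j` to the tail of the queue of machine `d`. -/
def join (Q : Queues m) (j : ℕ) (d : Fin m) : Queues m := Function.update Q d (Q d ++ [j])

/-- Delete `j` from all queues, keeping the order of the others. -/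
def leave (Q : Queues m) (j : ℕ) : Queues m := fun i => (Q i).erase j

/-- Job `j` of machine `i` wants to move to machine `d`: its virtual utility would increase
strictly, and by a factor of at least `1 + θ`. -/
def Profitable (I : Instance m) (θ : ℝ) (Q : Queues m) (j : ℕ) (i d : Fin m) : Prop :=
  j ∈ Q i ∧ d ≠ i ∧ utility I Q i j < joinUtility I Q d j ∧
    (1 + θ) * utility I Q i j ≤ joinUtility I Q d j

/-- A best response move of one job. -/
def Migrates (I : Instance m) (θ : ℝ) (Q R : Queues m) : Prop :=
  ∃ j i d, Profitable I θ Q j i d ∧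
    (∀ d', d' ≠ i → joinUtility I Q d' j ≤ joinUtility I Q d j) ∧
    R = join (leave Q j) j d

/-- A job that is released at time `t` joins the queue that maximizes its virtual utility. -/
def Arrives (I : Instance m) (t : ℝ) (Q R : Queues m) : Prop :=
  ∃ j d, j ∈ I.jobs ∧ I.release j = t ∧ (∀ i, j ∉ Q i) ∧
    (∀ d', joinUtility I Q d' j ≤ joinUtility I Q d j) ∧ R = join Q j d

/-- Nash equilibrium: no job wants to move. -/
def IsNash (I : Instance m) (θ : ℝ) (Q : Queues m) : Prop :=
  ∀ j i d, ¬ Profitable I θ Q j i d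

open Classical in
/-- The jobs completed by time `t` leave the queues. -/
noncomputable def depart (I : Instance m) (S : Schedule m) (t : ℝ) (Q : Queues m) : Queues m :=
  fun i => (Q i).filter fun j => ¬ Done I S j t

/-- `S` is a run of SelfishMigrate with rank parameter `k` and migration threshold `1 + θ` on
machines of speed `s` (`θ = 0` is the basic algorithm). The virtual queues `Q t` hold the active
jobs on their machines and determine the shares of the jobs. They are piecewise constant in
time; at each time `t`, starting from the queues just before `t`, the completed jobs depart, and
by arrivals of the jobs released at `t` and sequential best response moves a Nash equilibrium is
reached. -/
def IsSelfishMigrate (k : ℕ) (s θ : ℝ) (I : Instance m) (S : Schedule m) : Prop :=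
  ∃ Q : ℝ → Queues m,
    (∀ t i j, j ∈ Q t i ↔ Active I S j t ∧ S.mach j t = i) ∧
    (∀ t i, (Q t i).Nodup) ∧
    (∀ t i, ∀ j ∈ Q t i, S.power j t = share I k s (Q t i) j) ∧
    (∀ t, ∀ᶠ u in 𝓝[>] t, Q u = Q t) ∧
    (∀ t, ∃ Q₀ : Queues m, (∀ᶠ u in 𝓝[<] t, Q u = Q₀) ∧
      Relation.ReflTransGen (fun P R => Arrives I t P R ∨ Migrates I θ P R)
        (depart I S t Q₀) (Q t)) ∧
    ∀ t, IsNash I θ (Q t)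

end UnrelatedMachines

/-! The competitive ratio is proved by dual fitting. Let `load` of a job be (weight ahead + own
weight) · (processing power). Up to the factor `1/(s(k+1))`, the dual variable of a job is the
integral of its load, and the dual variable of machine `i` at time `t` is `1+θ` times its total
queue weight. Three facts make this work.

Ranked sharing gives `load ≤ s(k+1)w` for each job (`load_le`), while the loads in a queue add up to
at least `s(k+1)/(k+2)` times its weight (`le_sum_load_queue`).

The virtual utility of a job never decreases while it is active (`Improves`): arrivals and
migrations append at the tail, departures only remove weight ahead, and a mover gains. Together with
equilibrium at time `t`, this says that at every later time the job is served at least as well, up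
to `1+θ`, as at the tail of any queue at time `t` (`rate_mul_load_le`). Dual feasibility follows by
splitting the load integral at `t` (`dual_constraint`): the first part is bounded through the
elapsed time, the second through the processing length.

Weak duality against an arbitrary unit-speed schedule loses a factor 2 (`Feasible.weak_duality`).
Subtracting the machine duals from the job duals leaves the coefficient `(s(k+1)/(k+2) -
(1+θ))/(s(k+1))` in front of the integrated queue weight, which is the weighted flow-time. With `s =
1+ε`, `k` about `4/ε` and `θ ≤ ε/4`, the numerator is at least `ε/4`, and the ratio is `O(1+1/ε²)`.

Each migration multiplies the virtual utility by at least `1+θ`. It stays between `ℓ/(total weight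
of all jobs)` and `ℓ/w`, where `ℓ` is the rate on the last machine, so the number of migrations is
logarithmic (`migratesAtMost`).

The algorithm itself has to be built. Best response terminates because the sum of the utilities
strictly increases over finitely many queue states (`exists_nash`); a run is glued together from
finitely many events (`exists_trajectory_of_card`). All choices go through `settle`, which sees only
released jobs and no lengths, so the algorithm is non-clairvoyant (`IsSettledRun.queues_eq`). -/

namespace UnrelatedMachines
variable {m : ℕ}

/-! ### Weights of queues -/

@[simp] lemma totalWeight_nil (I : Instance m) : totalWeight I [] = 0 := by simp [totalWeight]

@[simp] lemma totalWeight_cons (I : Instance m) (a : ℕ) (L : List ℕ) :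
    totalWeight I (a :: L) = I.weight a + totalWeight I L := by simp [totalWeight]

@[simp] lemma totalWeight_append (I : Instance m) (L L' : List ℕ) :
    totalWeight I (L ++ L') = totalWeight I L + totalWeight I L' := by simp [totalWeight]

lemma totalWeight_nonneg {I : Instance m} {L : List ℕ} (hL : ∀ j ∈ L, 0 ≤ I.weight j) :
    0 ≤ totalWeight I L :=
  List.sum_nonneg (by simpa using hL)

lemma weightAhead_nonneg {I : Instance m} {L : List ℕ} (hL : ∀ j ∈ L, 0 ≤ I.weight j) (j : ℕ) :
    0 ≤ weightAhead I L j :=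
  totalWeight_nonneg fun _ hj' => hL _ ((List.takeWhile_sublist _).subset hj')

@[simp] lemma weightAhead_nil (I : Instance m) (j : ℕ) : weightAhead I [] j = 0 := by
  simp [weightAhead]

@[simp] lemma weightAhead_cons_self (I : Instance m) (L : List ℕ) (j : ℕ) :
    weightAhead I (j :: L) j = 0 := by simp [weightAhead]

lemma weightAhead_cons_of_ne (I : Instance m) (L : List ℕ) {a j : ℕ} (h : a ≠ j) :
    weightAhead I (a :: L) j = I.weight a + weightAhead I L j := by simp [weightAhead, h]

lemma weightAhead_append_of_mem (I : Instance m) {L : List ℕ} (L' : List ℕ) {j : ℕ} (hj : j ∈ L) :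
    weightAhead I (L ++ L') j = weightAhead I L j := by
  induction L with
  | nil => simp at hj
  | cons a L ih =>
    by_cases h : a = j
    · subst h; simp
    · have hj' : j ∈ L := (List.mem_cons.1 hj).resolve_left (Ne.symm h)
      rw [List.cons_append, weightAhead_cons_of_ne I _ h, weightAhead_cons_of_ne I _ h, ih hj']

lemma weightAhead_append_self (I : Instance m) {L : List ℕ} {j : ℕ} (hj : j ∉ L) :
    weightAhead I (L ++ [j]) j = totalWeight I L := by
  induction L with
  | nil => simp
  | cons a L ih =>
    simp only [List.mem_cons, not_or] at hj
    rw [List.cons_append, weightAhead_cons_of_ne I _ (Ne.symm hj.1), ih hj.2, totalWeight_cons]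

lemma weightAhead_add_le {I : Instance m} {L : List ℕ} (hL : ∀ j ∈ L, 0 ≤ I.weight j) {j : ℕ}
    (hj : j ∈ L) : weightAhead I L j + I.weight j ≤ totalWeight I L := by
  induction L with
  | nil => simp at hj
  | cons a L ih =>
    simp only [List.mem_cons, forall_eq_or_imp] at hL
    by_cases h : a = j
    · subst h
      simpa using totalWeight_nonneg hL.2
    · have hj' : j ∈ L := (List.mem_cons.1 hj).resolve_left (Ne.symm h)
      rw [weightAhead_cons_of_ne I _ h, totalWeight_cons]
      linarith [ih hL.2 hj']

lemma weightAhead_le_of_sublist {I : Instance m} {L' L : List ℕ} (h : L'.Sublist L)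
    (hL : ∀ j ∈ L, 0 ≤ I.weight j) (hd : L.Nodup) {j : ℕ} (hj : j ∈ L') :
    weightAhead I L' j ≤ weightAhead I L j := by
  induction h with
  | slnil => simp at hj
  | cons a h' ih =>
    simp only [List.mem_cons, forall_eq_or_imp] at hL
    rw [List.nodup_cons] at hd
    have hne : a ≠ j := fun h => hd.1 (h ▸ h'.subset hj)
    rw [weightAhead_cons_of_ne I _ hne]
    linarith [hL.1, ih hL.2 hd.2 hj]
  | cons_cons a h' ih =>
    simp only [List.mem_cons, forall_eq_or_imp] at hL
    rw [List.nodup_cons] at hd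
    by_cases hne : a = j
    · subst hne; simp
    · rw [weightAhead_cons_of_ne I _ hne, weightAhead_cons_of_ne I _ hne]
      linarith [ih hL.2 hd.2 ((List.mem_cons.1 hj).resolve_left (Ne.symm hne))]

/-- Telescoping along a queue. -/
lemma sum_map_weightAhead_sub (I : Instance m) (F : ℝ → ℝ) {L : List ℕ} (hd : L.Nodup) :
    (L.map fun j => F (weightAhead I L j + I.weight j) - F (weightAhead I L j)).sum =
      F (totalWeight I L) - F 0 := by
  -- Appending at the tail leaves the weight ahead of the earlier jobs unchanged, so induction from
  -- the tail adds one telescoping term.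
  induction L using List.reverseRecOn with
  | nil => simp
  | append_singleton L a ih =>
    have ha : a ∉ L := fun h => by
      rw [List.nodup_append] at hd
      exact hd.2.2 a h a (by simp) rfl
    have hL : L.Nodup := hd.sublist (List.sublist_append_left _ _)
    rw [List.map_append, List.sum_append]
    rw [List.map_congr_left (g := fun j => F (weightAhead I L j + I.weight j) -
      F (weightAhead I L j)) (fun j hj => by rw [weightAhead_append_of_mem I _ hj]), ih hL]
    simp [weightAhead_append_self I ha]

/-! ### Queues of active jobs -/

/-- The queues hold jobs of the instance, each of them at most once. -/
structure Valid (I : Instance m) (Q : Queues m) : Prop where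
  mem_jobs : ∀ i, ∀ j ∈ Q i, j ∈ I.jobs
  nodup : ∀ i, (Q i).Nodup
  disjoint : ∀ i i' j, j ∈ Q i → j ∈ Q i' → i = i'

namespace Valid

variable {I : Instance m} {Q R : Queues m}

lemma weight_nonneg (h : Valid I Q) (i : Fin m) : ∀ j ∈ Q i, 0 ≤ I.weight j :=
  fun j hj => (I.weight_pos j (h.mem_jobs i j hj)).le

lemma of_sublist (h : Valid I Q) (hR : ∀ i, (R i).Sublist (Q i)) : Valid I R where
  mem_jobs i j hj := h.mem_jobs i j ((hR i).subset hj)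
  nodup i := (h.nodup i).sublist (hR i)
  disjoint i i' j hj hj' := h.disjoint i i' j ((hR i).subset hj) ((hR i').subset hj')

lemma leave (h : Valid I Q) (j : ℕ) : Valid I (leave Q j) :=
  h.of_sublist fun _ => List.erase_sublist

lemma notMem_leave (h : Valid I Q) (j : ℕ) (i : Fin m) : j ∉ UnrelatedMachines.leave Q j i := by
  simp [UnrelatedMachines.leave, (h.nodup i).mem_erase_iff]

end Valid

lemma mem_join {Q : Queues m} {j j' : ℕ} {d i : Fin m} :
    j' ∈ join Q j d i ↔ j' ∈ Q i ∨ (j' = j ∧ i = d) := by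
  by_cases h : i = d
  · subst h; simp [join]
  · simp [join, h]

lemma join_self (Q : Queues m) (j : ℕ) (d : Fin m) : join Q j d d = Q d ++ [j] := by simp [join]

lemma Valid.join {I : Instance m} {Q : Queues m} (h : Valid I Q) {j : ℕ} (hj : j ∈ I.jobs)
    (hn : ∀ i, j ∉ Q i) (d : Fin m) : Valid I (join Q j d) where
  mem_jobs i j' hj' := by
    rcases mem_join.1 hj' with h' | h'
    · exact h.mem_jobs i j' h'
    · exact h'.1 ▸ hj
  nodup i := by
    by_cases hi : i = d
    · subst hi
      rw [join_self, List.nodup_append]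
      refine ⟨h.nodup i, by simp, ?_⟩
      rintro a ha b hb rfl
      simp only [List.mem_singleton] at hb
      exact hn i (hb ▸ ha)
    · simpa [UnrelatedMachines.join, hi] using h.nodup i
  disjoint i i' j' h1 h2 := by
    rcases mem_join.1 h1 with h1 | h1 <;> rcases mem_join.1 h2 with h2 | h2
    · exact h.disjoint i i' j' h1 h2
    · exact absurd (h2.1 ▸ h1) (hn i)
    · exact absurd (h1.1 ▸ h2) (hn i')
    · rw [h1.2, h2.2]

/-! ### Virtual utilities when jobs are deleted or appended -/

lemma utility_le_of_weightAhead_le {I : Instance m} {Q R : Queues m} {i : Fin m} {j : ℕ}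
    (hj : j ∈ I.jobs) (h0 : 0 ≤ weightAhead I (R i) j)
    (h : weightAhead I (R i) j ≤ weightAhead I (Q i) j) : utility I Q i j ≤ utility I R i j := by
  have := I.weight_pos j hj
  exact div_le_div_of_nonneg_left (I.rate_nonneg i j hj) (by linarith) (by linarith)

lemma utility_le_of_sublist {I : Instance m} {Q R : Queues m} (hQ : Valid I Q) {i : Fin m}
    (hs : (R i).Sublist (Q i)) {j : ℕ} (hj : j ∈ R i) : utility I Q i j ≤ utility I R i j :=
  utility_le_of_weightAhead_le (hQ.mem_jobs i j (hs.subset hj))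
    (weightAhead_nonneg (fun j' hj' => hQ.weight_nonneg i j' (hs.subset hj')) j)
    (weightAhead_le_of_sublist hs (hQ.weight_nonneg i) (hQ.nodup i) hj)

lemma utility_join_of_mem (I : Instance m) {Q : Queues m} {i : Fin m} {j j' : ℕ} (d : Fin m)
    (hj' : j' ∈ Q i) : utility I (join Q j d) i j' = utility I Q i j' := by
  by_cases hi : i = d
  · subst hi
    simp [utility, join_self, weightAhead_append_of_mem I _ hj']
  · simp [utility, join, hi]

lemma utility_join_self (I : Instance m) {Q : Queues m} {j : ℕ} {d : Fin m} (hj : j ∉ Q d) :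
    utility I (join Q j d) d j = joinUtility I Q d j := by
  simp [utility, joinUtility, join_self, weightAhead_append_self I hj]

lemma utility_nonneg {I : Instance m} {Q : Queues m} (hQ : Valid I Q) {i : Fin m} {j : ℕ}
    (hj : j ∈ Q i) : 0 ≤ utility I Q i j := by
  have hj' := hQ.mem_jobs i j hj
  have := weightAhead_nonneg (hQ.weight_nonneg i) j
  have := I.weight_pos j hj'
  exact div_nonneg (I.rate_nonneg i j hj') (by linarith)

/-! ### The virtual utility of a job does not decrease -/

/-- Passing from `Q` to `R`, job `j` stays in the queues, its virtual utility does not decrease,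
and if `j` changes its machine then it increases strictly and by a factor of `1 + θ`. -/
def Improves (I : Instance m) (θ : ℝ) (j : ℕ) (Q R : Queues m) : Prop :=
  ∀ i, j ∈ Q i → ∃ i', j ∈ R i' ∧ utility I Q i j ≤ utility I R i' j ∧
    (i ≠ i' → utility I Q i j < utility I R i' j ∧ (1 + θ) * utility I Q i j ≤ utility I R i' j)

lemma Improves.refl (I : Instance m) (θ : ℝ) (j : ℕ) (Q : Queues m) : Improves I θ j Q Q :=
  fun i hi => ⟨i, hi, le_rfl, fun h => absurd rfl h⟩

lemma Improves.trans {I : Instance m} {θ : ℝ} (hθ : 0 ≤ θ) {j : ℕ} {P Q R : Queues m}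
    (h : Improves I θ j P Q) (h' : Improves I θ j Q R) : Improves I θ j P R := by
  intro i hi
  obtain ⟨i', hi', h1, h2⟩ := h i hi
  obtain ⟨i'', hi'', h3, h4⟩ := h' i' hi'
  refine ⟨i'', hi'', h1.trans h3, fun hne => ?_⟩
  by_cases hne' : i = i'
  · subst hne'
    have := h4 hne
    exact ⟨h1.trans_lt this.1, (mul_le_mul_of_nonneg_left h1 (by linarith)).trans this.2⟩
  · have := h2 hne'
    exact ⟨this.1.trans_le h3, this.2.trans h3⟩

/-- Deleting other jobs can only remove weight ahead of `j`. -/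
lemma improves_of_sublist {I : Instance m} {θ : ℝ} {j : ℕ} {Q R : Queues m} (hQ : Valid I Q)
    (hs : ∀ i, (R i).Sublist (Q i)) (hj : ∀ i, j ∈ Q i → j ∈ R i) : Improves I θ j Q R :=
  fun i hi => ⟨i, hj i hi, utility_le_of_sublist hQ (hs i) (hj i hi), fun h => absurd rfl h⟩

lemma Arrives.valid {I : Instance m} {t : ℝ} {Q R : Queues m} (h : Arrives I t Q R)
    (hQ : Valid I Q) : Valid I R := by
  obtain ⟨j, d, hj, -, hn, -, rfl⟩ := h
  exact hQ.join hj hn d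

lemma Arrives.improves {I : Instance m} {t θ : ℝ} {Q R : Queues m} (h : Arrives I t Q R)
    (j : ℕ) : Improves I θ j Q R := by
  obtain ⟨j', d, -, -, -, -, rfl⟩ := h
  intro i hi
  exact ⟨i, mem_join.2 (.inl hi), (utility_join_of_mem I d hi).ge, fun h => absurd rfl h⟩

lemma Migrates.valid {I : Instance m} {θ : ℝ} {Q R : Queues m} (h : Migrates I θ Q R)
    (hQ : Valid I Q) : Valid I R := by
  obtain ⟨j, i, d, hp, -, rfl⟩ := h
  exact (hQ.leave j).join (hQ.mem_jobs i j hp.1) (hQ.notMem_leave j) d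

lemma Profitable.utility_join_leave {I : Instance m} {θ : ℝ} {Q : Queues m} {j : ℕ}
    {i d : Fin m} (hp : Profitable I θ Q j i d) (hQ : Valid I Q) :
    utility I (join (leave Q j) j d) d j = joinUtility I Q d j := by
  have : leave Q j d = Q d :=
    List.erase_of_not_mem fun h => hp.2.1 (hQ.disjoint _ _ _ h hp.1)
  rw [utility_join_self I (hQ.notMem_leave j d)]
  simp [joinUtility, this]

/-- The mover gains by the definition of a profitable move. Any other job may lose the mover from
ahead of it, and the mover reappears only at a tail. -/
lemma Migrates.improves {I : Instance m} {θ : ℝ} {Q R : Queues m} (h : Migrates I θ Q R)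
    (hQ : Valid I Q) (j : ℕ) : Improves I θ j Q R := by
  obtain ⟨j', i, d, hp, -, rfl⟩ := h
  intro i' hi'
  by_cases hjj : j = j'
  · subst hjj
    have hii : i' = i := hQ.disjoint _ _ _ hi' hp.1
    subst hii
    refine ⟨d, mem_join.2 (.inr ⟨rfl, rfl⟩), ?_⟩
    rw [hp.utility_join_leave hQ]
    exact ⟨hp.2.2.1.le, fun _ => hp.2.2⟩
  · have hm : j ∈ leave Q j' i' := (List.mem_erase_of_ne hjj).2 hi'
    refine ⟨i', mem_join.2 (.inl hm), ?_, fun h => absurd rfl h⟩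
    rw [utility_join_of_mem I d hm]
    exact utility_le_of_sublist hQ List.erase_sublist hm

/-- The elementary moves at time `t`. -/
def Step (I : Instance m) (t θ : ℝ) (Q R : Queues m) : Prop := Arrives I t Q R ∨ Migrates I θ Q R

lemma Step.valid {I : Instance m} {t θ : ℝ} {Q R : Queues m} (h : Step I t θ Q R)
    (hQ : Valid I Q) : Valid I R :=
  h.elim (fun h => h.valid hQ) fun h => h.valid hQ

lemma Step.improves {I : Instance m} {t θ : ℝ} {Q R : Queues m} (h : Step I t θ Q R)
    (hQ : Valid I Q) (j : ℕ) : Improves I θ j Q R :=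
  h.elim (fun h => h.improves j) fun h => h.improves hQ j

lemma valid_of_reflTransGen {I : Instance m} {t θ : ℝ} {Q R : Queues m}
    (h : Relation.ReflTransGen (Step I t θ) Q R) (hQ : Valid I Q) : Valid I R := by
  induction h with
  | refl => exact hQ
  | tail _ h ih => exact h.valid ih

lemma improves_of_reflTransGen {I : Instance m} {t θ : ℝ} (hθ : 0 ≤ θ) {Q R : Queues m}
    (h : Relation.ReflTransGen (Step I t θ) Q R) (hQ : Valid I Q) (j : ℕ) :
    Improves I θ j Q R := by
  induction h with
  | refl => exact Improves.refl I θ j Q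
  | tail h' h ih => exact ih.trans hθ (h.improves (valid_of_reflTransGen h' hQ) j)

/-- Every queued job has at least the virtual utility that it would get behind all jobs on its
fastest machine. -/
def UtilityBound (I : Instance m) (Q : Queues m) : Prop :=
  ∀ i, ∀ j ∈ Q i, ∀ d, I.rate d j / ∑ j' ∈ I.jobs, I.weight j' ≤ utility I Q i j

lemma totalWeight_eq_sum (I : Instance m) {L : List ℕ} (hd : L.Nodup) :
    totalWeight I L = ∑ j ∈ L.toFinset, I.weight j := (List.sum_toFinset _ hd).symm

/-- A newcomer picks the best tail, and at the tail of any queue the total weight including its own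
is at most the weight of all jobs. -/
lemma Arrives.utilityBound {I : Instance m} {t : ℝ} {Q R : Queues m} (h : Arrives I t Q R)
    (hQ : Valid I Q) (hb : UtilityBound I Q) : UtilityBound I R := by
  obtain ⟨j, d, hj, -, hn, hmax, rfl⟩ := h
  intro i j' hj' d'
  rcases mem_join.1 hj' with hm | ⟨rfl, rfl⟩
  · rw [utility_join_of_mem I d hm]
    exact hb i j' hm d'
  · rw [utility_join_self I (hn i)]
    refine le_trans ?_ (hmax d')
    have hw := I.weight_pos j' hj
    have h0 := totalWeight_nonneg (hQ.weight_nonneg d')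
    refine div_le_div_of_nonneg_left (I.rate_nonneg d' j' hj) (by linarith) ?_
    rw [totalWeight_eq_sum I (hQ.nodup d'), add_comm,
      ← Finset.sum_insert (a := j') (by simpa using hn d')]
    refine Finset.sum_le_sum_of_subset_of_nonneg ?_ fun a ha _ => (I.weight_pos a ha).le
    intro a ha
    rcases Finset.mem_insert.1 ha with rfl | ha
    · exact hj
    · exact hQ.mem_jobs d' a (by simpa using ha)

/-- The lower bound does not depend on the queues, so monotonicity of the utilities preserves it. -/
lemma Migrates.utilityBound {I : Instance m} {θ : ℝ} {Q R : Queues m} (h : Migrates I θ Q R)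
    (hQ : Valid I Q) (hb : UtilityBound I Q) : UtilityBound I R := by
  intro i j hj d
  have hR := h.valid hQ
  have hm : ∃ i₀, j ∈ Q i₀ := by
    obtain ⟨j', i', d', hp, -, rfl⟩ := h
    rcases mem_join.1 hj with hm | ⟨rfl, rfl⟩
    · exact ⟨i, List.mem_of_mem_erase hm⟩
    · exact ⟨i', hp.1⟩
  obtain ⟨i₀, hi₀⟩ := hm
  obtain ⟨i', hi', hle, -⟩ := h.improves hQ j i₀ hi₀
  obtain rfl := hR.disjoint _ _ _ hj hi'
  exact (hb i₀ j hi₀ d).trans hle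

lemma utilityBound_of_reflTransGen {I : Instance m} {t θ : ℝ} {Q R : Queues m}
    (h : Relation.ReflTransGen (Step I t θ) Q R) (hQ : Valid I Q) (hb : UtilityBound I Q) :
    UtilityBound I R := by
  induction h with
  | refl => exact hb
  | tail h' h ih =>
    exact h.elim (fun h => h.utilityBound (valid_of_reflTransGen h' hQ) ih)
      fun h => h.utilityBound (valid_of_reflTransGen h' hQ) ih

lemma UtilityBound.of_sublist {I : Instance m} {Q R : Queues m} (hQ : Valid I Q)
    (hb : UtilityBound I Q) (hs : ∀ i, (R i).Sublist (Q i)) : UtilityBound I R :=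
  fun i j hj d => (hb i j ((hs i).subset hj) d).trans (utility_le_of_sublist hQ (hs i) hj)

lemma depart_sublist (I : Instance m) (S : Schedule m) (t : ℝ) (Q : Queues m) (i : Fin m) :
    (depart I S t Q i).Sublist (Q i) := List.filter_sublist

lemma mem_depart {I : Instance m} {S : Schedule m} {t : ℝ} {Q : Queues m} {i : Fin m} {j : ℕ} :
    j ∈ depart I S t Q i ↔ j ∈ Q i ∧ ¬ Done I S j t := by
  classical simp [depart]

/-! ### Piecewise constant functions of time -/

/-- Real induction for a reflexive and transitive relation between the values of a function. -/
lemma rel_of_eventually {X : Type*} (f : ℝ → X) (R : X → X → Prop) (hrefl : ∀ x, R x x)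
    (htrans : ∀ x y z, R x y → R y z → R x z) {a b : ℝ} (hab : a ≤ b)
    (hright : ∀ t, a ≤ t → t < b → ∀ᶠ u in 𝓝[>] t, R (f t) (f u))
    (hleft : ∀ t, a < t → t ≤ b → ∀ᶠ u in 𝓝[<] t, R (f u) (f t)) : R (f a) (f b) := by
  -- The supremum of the reachable times is itself reachable by the condition from the left; if it
  -- were below `b`, the condition from the right would push it further.
  set s : Set ℝ := {x | a ≤ x ∧ x ≤ b ∧ R (f a) (f x)}
  have has : a ∈ s := ⟨le_rfl, hab, hrefl _⟩
  have hbdd : BddAbove s := ⟨b, fun x hx => hx.2.1⟩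
  have hac : a ≤ sSup s := le_csSup hbdd has
  have hcb : sSup s ≤ b := csSup_le ⟨a, has⟩ fun x hx => hx.2.1
  have hc : R (f a) (f (sSup s)) := by
    rcases hac.eq_or_lt with h | h
    · rw [← h]; exact hrefl _
    · obtain ⟨l, hl, hl'⟩ := (mem_nhdsLT_iff_exists_Ioo_subset' h).1 (hleft _ h hcb)
      obtain ⟨x, hx, hlx⟩ := exists_lt_of_lt_csSup ⟨a, has⟩ hl
      rcases (le_csSup hbdd hx).eq_or_lt with h' | h'
      · rw [← h']; exact hx.2.2
      · exact htrans _ _ _ hx.2.2 (hl' ⟨hlx, h'⟩)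
  rcases hcb.eq_or_lt with h | h
  · rwa [h] at hc
  · obtain ⟨r, hr, hr'⟩ := (mem_nhdsGT_iff_exists_Ioo_subset' h).1 (hright _ hac h)
    have hr0 : sSup s < min r b := lt_min hr h
    obtain ⟨x, hx, hx'⟩ := exists_between hr0
    have : x ∈ s := ⟨hac.trans hx.le, hx'.le.trans (min_le_right _ _),
      htrans _ _ _ hc (hr' ⟨hx, hx'.trans_le (min_le_left _ _)⟩)⟩
    exact absurd (le_csSup hbdd this) (not_le.2 hx)

/-- The grid points `(⌊(n+1)t⌋+1)/(n+1)` lie strictly to the right of `t` and tend to `t`. Along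
them `f` is eventually equal to `f t`, and for fixed `n` the approximation factors through the
integers. -/
lemma measurable_real_of_eventually_eq {f : ℝ → ℝ} (hf : ∀ t, ∀ᶠ u in 𝓝[>] t, f u = f t) :
    Measurable f := by
  have hlim : ∀ t : ℝ, Tendsto (fun n : ℕ => ((⌊((n : ℝ) + 1) * t⌋ : ℝ) + 1) / ((n : ℝ) + 1))
      atTop (𝓝[>] t) := by
    intro t
    refine tendsto_nhdsWithin_iff.2 ⟨?_, .of_forall fun n => ?_⟩
    · refine tendsto_of_tendsto_of_tendsto_of_le_of_le (g := fun _ => t)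
        (h := fun n : ℕ => t + 1 / ((n : ℝ) + 1)) tendsto_const_nhds ?_ ?_ ?_
      · simpa using (tendsto_const_nhds (x := t)).add
          (tendsto_one_div_add_atTop_nhds_zero_nat (𝕜 := ℝ))
      · intro n
        have : (0 : ℝ) < n + 1 := by positivity
        simp only
        rw [le_div_iff₀ this]
        linarith [Int.lt_floor_add_one (((n : ℝ) + 1) * t)]
      · intro n
        have : (0 : ℝ) < n + 1 := by positivity
        simp only
        rw [div_le_iff₀ this, add_mul t, div_mul_cancel₀ _ this.ne']
        linarith [Int.floor_le (((n : ℝ) + 1) * t)]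
    · have : (0 : ℝ) < n + 1 := by positivity
      simp only [Set.mem_Ioi]
      rw [lt_div_iff₀ this]
      linarith [Int.lt_floor_add_one (((n : ℝ) + 1) * t)]
  refine measurable_of_tendsto_metrizable
    (f := fun (n : ℕ) t => f (((⌊((n : ℝ) + 1) * t⌋ : ℝ) + 1) / ((n : ℝ) + 1))) ?_ ?_
  · intro n
    have h1 : Measurable fun z : ℤ => f (((z : ℝ) + 1) / ((n : ℝ) + 1)) := measurable_from_top
    exact h1.comp (Int.measurable_floor.comp (measurable_id.const_mul _))
  · rw [tendsto_pi_nhds]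
    intro t
    exact tendsto_const_nhds.congr' (((hlim t).eventually (hf t)).mono fun n hn => hn.symm)

/-- A function which is locally constant to the right of every point is measurable. -/
lemma measurable_of_eventually_eq {X : Type*} [MeasurableSpace X] {f : ℝ → X}
    (hf : ∀ t, ∀ᶠ u in 𝓝[>] t, f u = f t) : Measurable f := by
  classical
  intro A _
  -- Passing to indicators reduces to real values; no property of the set `A` is needed.
  have h : Measurable ((f ⁻¹' A).indicator fun _ => (1 : ℝ)) := by
    refine measurable_real_of_eventually_eq fun t => (hf t).mono fun u hu => ?_
    simp [Set.indicator_apply, hu]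
  exact (measurable_indicator_const_iff (1 : ℝ)).1 h

lemma measurable_comp_of_eventually_eq {X Y : Type*} [MeasurableSpace Y] {f : ℝ → X} (g : X → Y)
    (hf : ∀ t, ∀ᶠ u in 𝓝[>] t, f u = f t) : Measurable fun t => g (f t) :=
  measurable_of_eventually_eq fun t => (hf t).mono fun u hu => by rw [hu]

/-! ### Integrals of bounded functions of time -/

lemma intervalIntegrable_of_bounded {f : ℝ → ℝ} (hf : Measurable f) (B : ℝ) (hB : ∀ t, |f t| ≤ B)
    (a b : ℝ) : IntervalIntegrable f MeasureTheory.volume a b := by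
  rw [intervalIntegrable_iff]
  exact MeasureTheory.Measure.integrableOn_of_bounded (by simp [Set.uIoc])
    hf.aestronglyMeasurable (.of_forall hB)

/-- The part of a nonnegative function that comes before its primitive reaches `p` has integral
at most `p`. -/
lemma integral_ite_lt_le {f g : ℝ → ℝ} {a T p : ℝ} (haT : a ≤ T) (hp : 0 ≤ p) (hf : ∀ t, 0 ≤ f t)
    (hfi : ∀ x y, IntervalIntegrable f MeasureTheory.volume x y)
    (hgi : ∀ x y, IntervalIntegrable g MeasureTheory.volume x y)
    (hgf : ∀ t, g t ≤ f t)
    (hg : ∀ t, a ≤ t → p ≤ ∫ u in a..t, f u → g t = 0) : ∫ u in a..T, g u ≤ p := by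
  rcases le_or_gt (∫ u in a..T, f u) p with h | h
  · exact (intervalIntegral.integral_mono haT (hgi _ _) (hfi _ _) hgf).trans h
  · have hcont : ContinuousOn (fun x => ∫ u in a..x, f u) (Set.Icc a T) :=
      (intervalIntegral.continuous_primitive hfi a).continuousOn
    -- At `c` the primitive of `f` equals `p`; beyond `c` the function `g` vanishes.
    obtain ⟨c, hc, hcp⟩ := intermediate_value_Icc haT hcont
      (show p ∈ Set.Icc _ _ from ⟨by simpa using hp, h.le⟩)
    simp only at hcp
    have hz : ∫ u in c..T, g u = 0 := by
      refine intervalIntegral.integral_zero_ae (.of_forall fun u hu => ?_)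
      rw [Set.uIoc_of_le hc.2] at hu
      refine hg u (hc.1.trans hu.1.le) ?_
      rw [← hcp, ← intervalIntegral.integral_add_adjacent_intervals (hfi a c) (hfi c u)]
      linarith [intervalIntegral.integral_nonneg_of_forall (μ := MeasureTheory.volume) hu.1.le hf]
    rw [← intervalIntegral.integral_add_adjacent_intervals (hgi a c) (hgi c T), hz, add_zero,
      ← hcp]
    exact intervalIntegral.integral_mono hc.1 (hgi _ _) (hfi _ _) hgf


/-! ### Sequential best response reaches a Nash equilibrium -/

lemma finite_nodup_lists (s : Finset ℕ) : {l : List ℕ | l.Nodup ∧ ∀ j ∈ l, j ∈ s}.Finite := by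
  refine ((s.powerset.biUnion fun t => t.toList.permutations.toFinset).finite_toSet).subset ?_
  rintro l ⟨hl, hs⟩
  simp only [Finset.coe_biUnion, Set.mem_iUnion, Finset.mem_coe, List.mem_toFinset,
    List.mem_permutations, Finset.mem_powerset]
  exact ⟨l.toFinset, fun j hj => hs j (by simpa using hj), (List.toFinset_toList hl).symm⟩

lemma finite_valid (I : Instance m) : {Q : Queues m | Valid I Q}.Finite := by
  refine (Set.Finite.pi' fun _ : Fin m => finite_nodup_lists I.jobs).subset ?_
  exact fun Q hQ i => ⟨hQ.nodup i, hQ.mem_jobs i⟩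

open Classical in
/-- The virtual utility of a job, zero if it is not in a queue. -/
noncomputable def jobUtility (I : Instance m) (Q : Queues m) (j : ℕ) : ℝ :=
  ∑ i, if j ∈ Q i then utility I Q i j else 0

lemma jobUtility_eq {I : Instance m} {Q : Queues m} (hQ : Valid I Q) {i : Fin m} {j : ℕ}
    (hj : j ∈ Q i) : jobUtility I Q j = utility I Q i j := by
  rw [jobUtility, Finset.sum_eq_single i]
  · simp [hj]
  · intro i' _ hne
    rw [if_neg fun h => hne (hQ.disjoint _ _ _ h hj)]
  · simp

lemma jobUtility_nonneg {I : Instance m} {Q : Queues m} (hQ : Valid I Q) (j : ℕ) :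
    0 ≤ jobUtility I Q j := by
  refine Finset.sum_nonneg fun i _ => ?_
  split_ifs with h
  · exact utility_nonneg hQ h
  · exact le_rfl

/-- The sum of the utilities is a potential function: no job loses and the mover gains strictly.
This is why `Profitable` asks for strict increase in addition to the factor `1 + θ`, which alone is
no gain when the utility is zero. -/
lemma Migrates.sum_jobUtility_lt {I : Instance m} {θ : ℝ} {Q R : Queues m}
    (h : Migrates I θ Q R) (hQ : Valid I Q) :
    ∑ j ∈ I.jobs, jobUtility I Q j < ∑ j ∈ I.jobs, jobUtility I R j := by
  have hR := h.valid hQ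
  have himp := h.improves hQ
  obtain ⟨j, i, d, hp, -, rfl⟩ := h
  refine Finset.sum_lt_sum (fun j' _ => ?_) ⟨j, hQ.mem_jobs i j hp.1, ?_⟩
  · by_cases hj' : ∃ i', j' ∈ Q i'
    · obtain ⟨i', hi'⟩ := hj'
      obtain ⟨i'', hi'', hle, -⟩ := himp j' i' hi'
      rwa [jobUtility_eq hQ hi', jobUtility_eq hR hi'']
    · push Not at hj'
      have : jobUtility I Q j' = 0 := by simp [jobUtility, hj']
      rw [this]
      exact jobUtility_nonneg hR j'
  · rw [jobUtility_eq hQ hp.1, jobUtility_eq hR (mem_join.2 (.inr ⟨rfl, rfl⟩)),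
      hp.utility_join_leave hQ]
    exact hp.2.2.1

lemma Profitable.exists_migrates {I : Instance m} {θ : ℝ} {Q : Queues m} {j : ℕ} {i d : Fin m}
    (h : Profitable I θ Q j i d) : ∃ R, Migrates I θ Q R := by
  obtain ⟨d', hd', hmax⟩ := Finset.exists_max_image (Finset.univ.filter (· ≠ i))
    (fun d => joinUtility I Q d j) ⟨d, by simpa using h.2.1⟩
  simp only [Finset.mem_filter, Finset.mem_univ, true_and] at hd' hmax
  have hd := hmax d h.2.1
  exact ⟨_, j, i, d', ⟨h.1, hd', h.2.2.1.trans_le hd, h.2.2.2.trans hd⟩, hmax, rfl⟩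

/-- Among the finitely many reachable queue states, one of maximal potential admits no further move.
-/
lemma exists_nash {I : Instance m} {θ : ℝ} {Q : Queues m} (hQ : Valid I Q) :
    ∃ R, Relation.ReflTransGen (Migrates I θ) Q R ∧ IsNash I θ R := by
  have hval : ∀ R, Relation.ReflTransGen (Migrates I θ) Q R → Valid I R := fun R hR => by
    induction hR with
    | refl => exact hQ
    | tail _ h ih => exact h.valid ih
  obtain ⟨R, hR, hmax⟩ := Set.exists_max_image
    {R | Relation.ReflTransGen (Migrates I θ) Q R} (fun R => ∑ j ∈ I.jobs, jobUtility I R j)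
    ((finite_valid I).subset hval) ⟨Q, .refl⟩
  refine ⟨R, hR, fun j i d hp => ?_⟩
  obtain ⟨R', hR'⟩ := hp.exists_migrates
  exact absurd (hmax R' (hR.tail hR')) (not_le.2 (hR'.sum_jobUtility_lt (hval R hR)))

lemma Migrates.mem {I : Instance m} {θ : ℝ} {Q R : Queues m} (h : Migrates I θ Q R)
    (hQ : Valid I Q) {j : ℕ} (hj : ∃ i, j ∈ Q i) : ∃ i, j ∈ R i := by
  obtain ⟨i, hi⟩ := hj
  obtain ⟨i', hi', -⟩ := h.improves hQ j i hi
  exact ⟨i', hi'⟩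

lemma exists_arrivals (hm : 0 < m) {I : Instance m} {t : ℝ} {Q : Queues m} (hQ : Valid I Q)
    (s : Finset ℕ) (hs : ∀ j ∈ s, j ∈ I.jobs ∧ I.release j = t) :
    ∃ R, Relation.ReflTransGen (Arrives I t) Q R ∧ Valid I R ∧ (∀ i, ∀ j ∈ Q i, j ∈ R i) ∧
      ∀ j ∈ s, ∃ i, j ∈ R i := by
  classical
  have : Nonempty (Fin m) := ⟨⟨0, hm⟩⟩
  induction s using Finset.induction_on with
  | empty => exact ⟨Q, .refl, hQ, fun _ _ h => h, by simp⟩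
  | insert j s _ ih =>
    obtain ⟨R, hR, hv, hsub, hin⟩ := ih fun j' hj' => hs j' (Finset.mem_insert_of_mem hj')
    by_cases hj : ∃ i, j ∈ R i
    · refine ⟨R, hR, hv, hsub, fun j' hj' => ?_⟩
      rcases Finset.mem_insert.1 hj' with rfl | h
      · exact hj
      · exact hin j' h
    · push Not at hj
      obtain ⟨d, -, hd⟩ := Finset.exists_max_image Finset.univ (fun d => joinUtility I R d j)
        Finset.univ_nonempty
      have hj' := hs j (Finset.mem_insert_self _ _)
      have ha : Arrives I t R (join R j d) :=
        ⟨j, d, hj'.1, hj'.2, hj, fun d' => hd d' (Finset.mem_univ _), rfl⟩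
      refine ⟨_, hR.tail ha, ha.valid hv, fun i a h => mem_join.2 (.inl (hsub i a h)), ?_⟩
      intro a haa
      rcases Finset.mem_insert.1 haa with rfl | h
      · exact ⟨d, mem_join.2 (.inr ⟨rfl, rfl⟩)⟩
      · obtain ⟨i, hi⟩ := hin a h
        exact ⟨i, mem_join.2 (.inl hi)⟩

/-- `R` is a possible outcome of the moves at time `t` from the queues `Q`. -/
def IsOutcome (I : Instance m) (t θ : ℝ) (Q R : Queues m) : Prop :=
  Relation.ReflTransGen (Step I t θ) Q R ∧ IsNash I θ R ∧
    ∀ j ∈ I.jobs, I.release j = t → ∃ i, j ∈ R i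

/-- A fixed outcome of the moves at time `t` from the queues `Q`. -/
noncomputable def settle (I : Instance m) (t θ : ℝ) (Q : Queues m) : Queues m :=
  Classical.epsilon (IsOutcome I t θ Q)

lemma isOutcome_settle (hm : 0 < m) {I : Instance m} {t θ : ℝ} {Q : Queues m} (hQ : Valid I Q) :
    IsOutcome I t θ Q (settle I t θ Q) := by
  refine Classical.epsilon_spec (p := IsOutcome I t θ Q) ?_
  obtain ⟨R, hR, hv, -, hin⟩ := exists_arrivals hm (t := t) hQ
    (I.jobs.filter fun j => I.release j = t) (by simp)
  obtain ⟨P, hP, hn⟩ := exists_nash (θ := θ) hv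
  refine ⟨P, Relation.ReflTransGen.trans
    (Relation.ReflTransGen.mono (r := Arrives I t) (fun _ _ h => Or.inl h) _ _ hR)
    (Relation.ReflTransGen.mono (r := Migrates I θ) (fun _ _ h => Or.inr h) _ _ hP), hn, ?_⟩
  intro j hj ht
  have h0 := hin j (by simp [hj, ht])
  have : Valid I P ∧ ∃ i, j ∈ P i := by
    clear hn
    induction hP with
    | refl => exact ⟨hv, h0⟩
    | tail _ h ih => exact ⟨h.valid ih.1, h.mem ih.1 ih.2⟩
  exact this.2

/-- Nothing happens in an equilibrium when no job arrives. -/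
lemma settle_eq_self {I : Instance m} {t θ : ℝ} {Q : Queues m} (hn : IsNash I θ Q)
    (h : ∀ j ∈ I.jobs, I.release j ≠ t) : settle I t θ Q = Q := by
  have hQ : IsOutcome I t θ Q Q := ⟨.refl, hn, fun j hj ht => absurd ht (h j hj)⟩
  have h1 : IsOutcome I t θ Q (settle I t θ Q) :=
    Classical.epsilon_spec (p := IsOutcome I t θ Q) ⟨Q, hQ⟩
  rcases h1.1.cases_head with h2 | ⟨R, h2, -⟩
  · exact h2.symm
  · rcases h2 with ⟨j, -, hj, ht, -⟩ | ⟨j, i, d, hp, -⟩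
    · exact absurd ht (h j hj)
    · exact absurd hp (hn j i d)

/-- The jobs in the queues after the moves at time `t`. -/
lemma mem_of_reflTransGen_step {I : Instance m} {t θ : ℝ} {Q R : Queues m}
    (h : Relation.ReflTransGen (Step I t θ) Q R) {j : ℕ} (hj : ∃ i, j ∈ R i) :
    (∃ i, j ∈ Q i) ∨ (j ∈ I.jobs ∧ I.release j = t) := by
  induction h with
  | refl => exact .inl hj
  | tail h' h ih =>
    rcases h with ⟨j', d, h1, h2, -, -, rfl⟩ | ⟨j', i', d, hp, -, rfl⟩
    · obtain ⟨i, hi⟩ := hj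
      rcases mem_join.1 hi with hi | ⟨rfl, -⟩
      · exact ih ⟨i, hi⟩
      · exact .inr ⟨h1, h2⟩
    · obtain ⟨i, hi⟩ := hj
      rcases mem_join.1 hi with hi | ⟨rfl, -⟩
      · exact ih ⟨i, List.mem_of_mem_erase hi⟩
      · exact ih ⟨i', hp.1⟩

/-! ### The moves depend only on the released jobs -/

/-- Two instances have the same released jobs at time `t`, apart from processing lengths. -/
def Agree (I₁ I₂ : Instance m) (t : ℝ) : Prop :=
  (∀ j, (j ∈ I₁.jobs ∧ I₁.release j ≤ t) ↔ (j ∈ I₂.jobs ∧ I₂.release j ≤ t)) ∧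
  ∀ j ∈ I₁.jobs, I₁.release j ≤ t →
    I₁.release j = I₂.release j ∧ I₁.weight j = I₂.weight j ∧ ∀ i, I₁.rate i j = I₂.rate i j

lemma Agree.symm {I₁ I₂ : Instance m} {t : ℝ} (h : Agree I₁ I₂ t) : Agree I₂ I₁ t := by
  refine ⟨fun j => (h.1 j).symm, fun j hj ht => ?_⟩
  have h' := (h.1 j).2 ⟨hj, ht⟩
  obtain ⟨h1, h2, h3⟩ := h.2 j h'.1 h'.2
  exact ⟨h1.symm, h2.symm, fun i => (h3 i).symm⟩

lemma Agree.mono {I₁ I₂ : Instance m} {t u : ℝ} (h : Agree I₁ I₂ t) (hu : u ≤ t) :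
    Agree I₁ I₂ u := by
  refine ⟨fun j => ⟨fun hj => ?_, fun hj => ?_⟩, fun j hj hju => h.2 j hj (hju.trans hu)⟩
  · have h1 := (h.1 j).1 ⟨hj.1, hj.2.trans hu⟩
    have h2 := (h.2 j hj.1 (hj.2.trans hu)).1
    exact ⟨h1.1, h2 ▸ hj.2⟩
  · have h1 := (h.1 j).2 ⟨hj.1, hj.2.trans hu⟩
    have h2 := (h.2 j h1.1 h1.2).1
    exact ⟨h1.1, h2 ▸ hj.2⟩

/-- All queued jobs are released by time `t`. -/
def Released (I : Instance m) (t : ℝ) (Q : Queues m) : Prop :=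
  ∀ i, ∀ j ∈ Q i, j ∈ I.jobs ∧ I.release j ≤ t

lemma Agree.released {I₁ I₂ : Instance m} {t : ℝ} (h : Agree I₁ I₂ t) {Q : Queues m}
    (hQ : Released I₁ t Q) : Released I₂ t Q :=
  fun i j hj => (h.1 j).1 (hQ i j hj)

lemma Agree.totalWeight_eq {I₁ I₂ : Instance m} {t : ℝ} (h : Agree I₁ I₂ t) {L : List ℕ}
    (hL : ∀ j ∈ L, j ∈ I₁.jobs ∧ I₁.release j ≤ t) : totalWeight I₁ L = totalWeight I₂ L := by
  unfold totalWeight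
  rw [List.map_congr_left fun j hj => (h.2 j (hL j hj).1 (hL j hj).2).2.1]

lemma Agree.weightAhead_eq {I₁ I₂ : Instance m} {t : ℝ} (h : Agree I₁ I₂ t) {L : List ℕ}
    (hL : ∀ j ∈ L, j ∈ I₁.jobs ∧ I₁.release j ≤ t) (j : ℕ) :
    weightAhead I₁ L j = weightAhead I₂ L j :=
  h.totalWeight_eq fun _ hj' => hL _ ((List.takeWhile_sublist _).subset hj')

lemma Agree.utility_eq {I₁ I₂ : Instance m} {t : ℝ} (h : Agree I₁ I₂ t) {Q : Queues m}
    (hQ : Released I₁ t Q) (i : Fin m) {j : ℕ} (hj : j ∈ I₁.jobs) (ht : I₁.release j ≤ t) :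
    utility I₁ Q i j = utility I₂ Q i j := by
  obtain ⟨-, h2, h3⟩ := h.2 j hj ht
  rw [utility, utility, h3, h2, h.weightAhead_eq (hQ i)]

lemma Agree.joinUtility_eq {I₁ I₂ : Instance m} {t : ℝ} (h : Agree I₁ I₂ t) {Q : Queues m}
    (hQ : Released I₁ t Q) (i : Fin m) {j : ℕ} (hj : j ∈ I₁.jobs) (ht : I₁.release j ≤ t) :
    joinUtility I₁ Q i j = joinUtility I₂ Q i j := by
  obtain ⟨-, h2, h3⟩ := h.2 j hj ht
  rw [joinUtility, joinUtility, h3, h2, h.totalWeight_eq (hQ i)]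

lemma Agree.profitable {I₁ I₂ : Instance m} {t θ : ℝ} (h : Agree I₁ I₂ t) {Q : Queues m}
    (hQ : Released I₁ t Q) {j : ℕ} {i d : Fin m} (hp : Profitable I₁ θ Q j i d) :
    Profitable I₂ θ Q j i d := by
  have hj := hQ i j hp.1
  have h1 := h.utility_eq hQ i hj.1 hj.2
  have h2 := h.joinUtility_eq hQ d hj.1 hj.2
  exact ⟨hp.1, hp.2.1, h1 ▸ h2 ▸ hp.2.2.1, h1 ▸ h2 ▸ hp.2.2.2⟩

lemma Agree.isNash {I₁ I₂ : Instance m} {t θ : ℝ} (h : Agree I₁ I₂ t) {Q : Queues m}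
    (hQ : Released I₁ t Q) (hn : IsNash I₁ θ Q) : IsNash I₂ θ Q :=
  fun j i d hp => hn j i d (h.symm.profitable (h.released hQ) hp)

/-- A move involves only weights and rates of queued jobs and of the arriving job, all released by
time `t`; processing lengths do not enter. -/
lemma Agree.step {I₁ I₂ : Instance m} {t θ : ℝ} (h : Agree I₁ I₂ t) {Q R : Queues m}
    (hQ : Released I₁ t Q) (hs : Step I₁ t θ Q R) : Step I₂ t θ Q R ∧ Released I₁ t R := by
  rcases hs with ⟨j, d, hj, ht, hn, hmax, rfl⟩ | ⟨j, i, d, hp, hmax, rfl⟩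
  · refine ⟨.inl ⟨j, d, ((h.1 j).1 ⟨hj, ht.le⟩).1, ?_, hn, fun d' => ?_, rfl⟩, fun i j' hj' => ?_⟩
    · rw [← (h.2 j hj ht.le).1, ht]
    · rw [← h.joinUtility_eq hQ d' hj ht.le, ← h.joinUtility_eq hQ d hj ht.le]
      exact hmax d'
    · rcases mem_join.1 hj' with h' | ⟨rfl, -⟩
      · exact hQ i j' h'
      · exact ⟨hj, ht.le⟩
  · have hj := hQ i j hp.1
    refine ⟨.inr ⟨j, i, d, h.profitable hQ hp, fun d' hd' => ?_, rfl⟩, fun i' j' hj' => ?_⟩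
    · rw [← h.joinUtility_eq hQ d' hj.1 hj.2, ← h.joinUtility_eq hQ d hj.1 hj.2]
      exact hmax d' hd'
    · rcases mem_join.1 hj' with h' | ⟨rfl, -⟩
      · exact hQ i' j' (List.mem_of_mem_erase h')
      · exact hj

lemma Agree.isOutcome {I₁ I₂ : Instance m} {t θ : ℝ} (h : Agree I₁ I₂ t) {Q R : Queues m}
    (hQ : Released I₁ t Q) (hR : IsOutcome I₁ t θ Q R) : IsOutcome I₂ t θ Q R := by
  have key : Relation.ReflTransGen (Step I₂ t θ) Q R ∧ Released I₁ t R := by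
    have := hR.1
    clear hR
    induction this with
    | refl => exact ⟨.refl, hQ⟩
    | tail _ hs ih => exact ⟨ih.1.tail (h.step ih.2 hs).1, (h.step ih.2 hs).2⟩
  refine ⟨key.1, h.isNash key.2 hR.2.1, fun j hj ht => ?_⟩
  have h' := (h.1 j).2 ⟨hj, ht.le⟩
  exact hR.2.2 j h'.1 ((h.2 j h'.1 h'.2).1.trans ht)

/-- `settle` is a choice from the predicate `IsOutcome`. The two instances give the same predicate,
so the same queues are chosen; this is where non-clairvoyance originates. -/
lemma Agree.settle_eq {I₁ I₂ : Instance m} {t : ℝ} (h : Agree I₁ I₂ t) (θ : ℝ) {Q : Queues m}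
    (hQ : Released I₁ t Q) : settle I₁ t θ Q = settle I₂ t θ Q := by
  have : IsOutcome I₁ t θ Q = IsOutcome I₂ t θ Q :=
    funext fun R => propext ⟨h.isOutcome hQ, h.symm.isOutcome (h.released hQ)⟩
  rw [settle, settle, this]

lemma Agree.share_eq {I₁ I₂ : Instance m} {t : ℝ} (h : Agree I₁ I₂ t) (k : ℕ) (s : ℝ)
    {L : List ℕ} (hL : ∀ j ∈ L, j ∈ I₁.jobs ∧ I₁.release j ≤ t) {j : ℕ} (hj : j ∈ L) :
    share I₁ k s L j = share I₂ k s L j := by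
  rw [share, share, h.weightAhead_eq hL, h.totalWeight_eq hL,
    (h.2 j (hL j hj).1 (hL j hj).2).2.1]


/-! ### Shares and processing speeds -/

lemma pow_sub_pow_nonneg {x w : ℝ} (hx : 0 ≤ x) (hw : 0 ≤ w) (k : ℕ) :
    0 ≤ (x + w) ^ k - x ^ k :=
  sub_nonneg.2 (pow_le_pow_left₀ hx (by linarith) k)

lemma Valid.totalWeight_pos {I : Instance m} {Q : Queues m} (hQ : Valid I Q) {i : Fin m} {j : ℕ}
    (hj : j ∈ Q i) : 0 < totalWeight I (Q i) := by
  have h1 := weightAhead_add_le (hQ.weight_nonneg i) hj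
  have h2 := weightAhead_nonneg (hQ.weight_nonneg i) j
  linarith [I.weight_pos j (hQ.mem_jobs i j hj)]

lemma share_nonneg {I : Instance m} {Q : Queues m} (hQ : Valid I Q) (k : ℕ) {s : ℝ} (hs : 0 ≤ s)
    {i : Fin m} {j : ℕ} (hj : j ∈ Q i) : 0 ≤ share I k s (Q i) j := by
  have h1 := pow_sub_pow_nonneg (weightAhead_nonneg (hQ.weight_nonneg i) j)
    (I.weight_pos j (hQ.mem_jobs i j hj)).le (k + 1)
  have h2 := hQ.totalWeight_pos hj
  exact div_nonneg (mul_nonneg hs h1) (by positivity)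

/-- The shares of the jobs in a nonempty queue add up to the speed of the machine. -/
lemma sum_share {I : Instance m} {Q : Queues m} (hQ : Valid I Q) (k : ℕ) (s : ℝ) (i : Fin m)
    (hne : Q i ≠ []) : ∑ j ∈ (Q i).toFinset, share I k s (Q i) j = s := by
  obtain ⟨j, hj⟩ := List.exists_mem_of_ne_nil _ hne
  have h2 := hQ.totalWeight_pos hj
  have h := sum_map_weightAhead_sub I (fun x => x ^ (k + 1)) (hQ.nodup i)
  rw [← List.sum_toFinset _ (hQ.nodup i)] at h
  simp only [share]
  rw [← Finset.sum_div, ← Finset.mul_sum, h]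
  field_simp
  simp

lemma sum_share_le {I : Instance m} {Q : Queues m} (hQ : Valid I Q) (k : ℕ) {s : ℝ} (hs : 0 ≤ s)
    (i : Fin m) : ∑ j ∈ (Q i).toFinset, share I k s (Q i) j ≤ s := by
  by_cases hne : Q i = []
  · simpa [hne] using hs
  · exact (sum_share hQ k s i hne).le

lemma share_le {I : Instance m} {Q : Queues m} (hQ : Valid I Q) (k : ℕ) {s : ℝ} (hs : 0 ≤ s)
    {i : Fin m} {j : ℕ} (hj : j ∈ Q i) : share I k s (Q i) j ≤ s :=
  (Finset.single_le_sum (f := fun j => share I k s (Q i) j)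
    (fun _ h => share_nonneg hQ k hs (by simpa using h)) (by simpa using hj)).trans
    (sum_share_le hQ k hs i)

open Classical in
/-- The speed at which a job is processed under the given queues. -/
noncomputable def speed (I : Instance m) (k : ℕ) (s : ℝ) (Q : Queues m) (j : ℕ) : ℝ :=
  ∑ i, if j ∈ Q i then I.rate i j * share I k s (Q i) j else 0

lemma speed_eq {I : Instance m} {Q : Queues m} (hQ : Valid I Q) (k : ℕ) (s : ℝ) {i : Fin m} {j : ℕ}
    (hj : j ∈ Q i) : speed I k s Q j = I.rate i j * share I k s (Q i) j := by
  rw [speed, Finset.sum_eq_single i]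
  · simp [hj]
  · intro i' _ hne
    rw [if_neg fun h => hne (hQ.disjoint _ _ _ h hj)]
  · simp

lemma speed_eq_zero (I : Instance m) {Q : Queues m} (k : ℕ) (s : ℝ) {j : ℕ}
    (hj : ∀ i, j ∉ Q i) : speed I k s Q j = 0 := by simp [speed, hj]

lemma speed_nonneg {I : Instance m} {Q : Queues m} (hQ : Valid I Q) (k : ℕ) {s : ℝ} (hs : 0 ≤ s)
    (j : ℕ) : 0 ≤ speed I k s Q j := by
  by_cases hj : ∃ i, j ∈ Q i
  · obtain ⟨i, hi⟩ := hj
    rw [speed_eq hQ k s hi]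
    exact mul_nonneg (I.rate_nonneg i j (hQ.mem_jobs i j hi)) (share_nonneg hQ k hs hi)
  · rw [speed_eq_zero I k s (by simpa using hj)]

lemma speed_le {I : Instance m} {Q : Queues m} (hQ : Valid I Q) (k : ℕ) {s : ℝ} (hs : 0 ≤ s)
    (j : ℕ) : speed I k s Q j ≤ ∑ i, |I.rate i j| * s := by
  by_cases hj : ∃ i, j ∈ Q i
  · obtain ⟨i, hi⟩ := hj
    rw [speed_eq hQ k s hi]
    refine le_trans ?_ (Finset.single_le_sum (f := fun i => |I.rate i j| * s)
      (fun i _ => by positivity) (Finset.mem_univ i))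
    exact mul_le_mul (le_abs_self _) (share_le hQ k hs hi) (share_nonneg hQ k hs hi) (abs_nonneg _)
  · rw [speed_eq_zero I k s (by simpa using hj)]
    exact Finset.sum_nonneg fun i _ => by positivity

lemma intervalIntegrable_speed {I : Instance m} {k : ℕ} {s : ℝ} (hs : 0 ≤ s) {q : ℝ → Queues m}
    (hq : ∀ t, ∀ᶠ u in 𝓝[>] t, q u = q t) (hv : ∀ t, Valid I (q t)) (j : ℕ) (a b : ℝ) :
    IntervalIntegrable (fun u => speed I k s (q u) j) MeasureTheory.volume a b := by
  refine intervalIntegrable_of_bounded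
    (measurable_comp_of_eventually_eq (fun Q => speed I k s Q j) hq) (∑ i, |I.rate i j| * s)
    (fun t => ?_) a b
  rw [abs_of_nonneg (speed_nonneg (hv t) k hs j)]
  exact speed_le (hv t) k hs j

/-! ### Construction of a run -/

open Classical in
/-- Delete the jobs for which the amount of work `Y` suffices. -/
noncomputable def unfinished (I : Instance m) (Y : ℕ → ℝ) (Q : Queues m) : Queues m :=
  fun i => (Q i).filter fun j => Y j < I.size j

lemma mem_unfinished {I : Instance m} {Y : ℕ → ℝ} {Q : Queues m} {i : Fin m} {j : ℕ} :
    j ∈ unfinished I Y Q i ↔ j ∈ Q i ∧ Y j < I.size j := by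
  classical simp [unfinished]

lemma unfinished_sublist (I : Instance m) (Y : ℕ → ℝ) (Q : Queues m) (i : Fin m) :
    (unfinished I Y Q i).Sublist (Q i) := List.filter_sublist

lemma unfinished_eq_self {I : Instance m} {Y : ℕ → ℝ} {Q : Queues m}
    (h : ∀ i, ∀ j ∈ Q i, Y j < I.size j) : unfinished I Y Q = Q := by
  classical
  funext i
  exact List.filter_eq_self.2 fun j hj => by simpa using h i j hj

lemma depart_eq_unfinished {I : Instance m} {S : Schedule m} {t : ℝ} {Y : ℕ → ℝ} {Q : Queues m}
    (h : ∀ i, ∀ j ∈ Q i, ¬ Done I S j t ↔ Y j < I.size j) :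
    depart I S t Q = unfinished I Y Q := by
  classical
  funext i
  exact List.filter_congr fun j hj => decide_eq_decide.2 (h i j hj)

/-- Queues in equilibrium at time `t` that hold the active jobs, given the work `Y` done by time
`t`. -/
structure Settled (I : Instance m) (θ t : ℝ) (Y : ℕ → ℝ) (Q : Queues m) : Prop where
  valid : Valid I Q
  nash : IsNash I θ Q
  mem_iff : ∀ j, (∃ i, j ∈ Q i) ↔ j ∈ I.jobs ∧ I.release j ≤ t ∧ Y j < I.size j

/-- Queues stay settled as long as there are no arrivals and completions. -/
lemma Settled.advance {I : Instance m} {θ t u : ℝ} {Y Z : ℕ → ℝ} {Q : Queues m}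
    (h : Settled I θ t Y Q) (htu : t ≤ u) (hrel : ∀ j ∈ I.jobs, t < I.release j → u < I.release j)
    (hYZ : ∀ j, Y j ≤ Z j) (hZ : ∀ j ∈ I.jobs, Y j < I.size j → Z j < I.size j) :
    Settled I θ u Z Q := by
  refine ⟨h.valid, h.nash, fun j => (h.mem_iff j).trans ⟨?_, ?_⟩⟩
  · rintro ⟨h1, h2, h3⟩
    exact ⟨h1, h2.trans htu, hZ j h1 h3⟩
  · rintro ⟨h1, h2, h3⟩
    exact ⟨h1, not_lt.1 fun h' => absurd (hrel j h1 h') (not_lt.2 h2), (hYZ j).trans_lt h3⟩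

/-- Queues are settled after the moves at a time of arrivals or completions. -/
lemma Settled.settle (hm : 0 < m) {I : Instance m} {θ t u : ℝ} (hθ : 0 ≤ θ) {Y Z : ℕ → ℝ}
    {Q : Queues m} (h : Settled I θ t Y Q) (htu : t < u)
    (hrel : ∀ j ∈ I.jobs, t < I.release j → u ≤ I.release j)
    (hYZ : ∀ j, Y j ≤ Z j) (hZ : ∀ j ∈ I.jobs, t < I.release j → Z j = 0) :
    Settled I θ u Z (UnrelatedMachines.settle I u θ (unfinished I Z Q)) := by
  have hv := h.valid.of_sublist (unfinished_sublist I Z Q)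
  obtain ⟨hchain, hnash, harr⟩ := isOutcome_settle hm (t := u) (θ := θ) hv
  refine ⟨valid_of_reflTransGen hchain hv, hnash, fun j => ⟨fun hj => ?_, ?_⟩⟩
  · rcases mem_of_reflTransGen_step hchain hj with ⟨i, hi⟩ | ⟨h1, h2⟩
    · rw [mem_unfinished] at hi
      have := (h.mem_iff j).1 ⟨i, hi.1⟩
      exact ⟨this.1, this.2.1.trans htu.le, hi.2⟩
    · refine ⟨h1, h2.le, ?_⟩
      rw [hZ j h1 (h2 ▸ htu)]
      exact I.size_pos j h1
  · rintro ⟨h1, h2, h3⟩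
    -- A job released by `t` was already queued and survives the deletions; a later one has release
    -- time exactly `u`, since no release lies strictly between.
    rcases le_or_gt (I.release j) t with h4 | h4
    · obtain ⟨i, hi⟩ := (h.mem_iff j).2 ⟨h1, h4, (hYZ j).trans_lt h3⟩
      obtain ⟨i', hi', -⟩ :=
        improves_of_reflTransGen hθ hchain hv j i (mem_unfinished.2 ⟨hi, h3⟩)
      exact ⟨i', hi'⟩
    · exact harr j h1 (le_antisymm h2 (hrel j h1 h4))

/-- `q` is a trajectory of the queues from time `τ` on, with work `y` done by time `τ`. -/
structure Trajectory (I : Instance m) (k : ℕ) (s θ τ : ℝ) (y : ℕ → ℝ) (q : ℝ → Queues m) :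
    Prop where
  right : ∀ t, ∀ᶠ u in 𝓝[>] t, q u = q t
  settled : ∀ t, τ ≤ t →
    Settled I θ t (fun j => y j + ∫ u in τ..t, speed I k s (q u) j) (q t)
  left : ∀ t, τ < t → ∃ Q₀ : Queues m, (∀ᶠ u in 𝓝[<] t, q u = Q₀) ∧
    q t = UnrelatedMachines.settle I t θ
      (unfinished I (fun j => y j + ∫ u in τ..t, speed I k s (q u) j) Q₀)

/-- The times of the next arrivals and completions when the queues do not change. -/
noncomputable def nextEvents (I : Instance m) (k : ℕ) (s τ : ℝ) (y : ℕ → ℝ) (Q : Queues m) :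
    Finset ℝ :=
  (I.jobs.filter fun j => τ < I.release j).image I.release ∪
    (I.jobs.filter fun j => y j < I.size j ∧ 0 < speed I k s Q j).image
      fun j => τ + (I.size j - y j) / speed I k s Q j

lemma lt_of_mem_nextEvents {I : Instance m} {k : ℕ} {s τ : ℝ} {y : ℕ → ℝ} {Q : Queues m} {t : ℝ}
    (ht : t ∈ nextEvents I k s τ y Q) : τ < t := by
  simp only [nextEvents, Finset.mem_union, Finset.mem_image, Finset.mem_filter] at ht
  rcases ht with ⟨j, ⟨-, h⟩, rfl⟩ | ⟨j, ⟨-, h, h'⟩, rfl⟩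
  · exact h
  · have := div_pos (sub_pos.2 h) h'
    linarith

/-- Before the next event the queues stay settled. -/
lemma Settled.advance_of_lt_nextEvents {I : Instance m} {k : ℕ} {s θ τ t : ℝ} (hs : 0 ≤ s)
    {y : ℕ → ℝ} {Q : Queues m} (h : Settled I θ τ y Q) (ht : τ ≤ t)
    (hlt : ∀ u ∈ nextEvents I k s τ y Q, t < u) :
    Settled I θ t (fun j => y j + (t - τ) * speed I k s Q j) Q := by
  refine h.advance ht (fun j hj hjt => hlt _ ?_) (fun j => ?_) (fun j hj hy => ?_)
  · exact Finset.mem_union_left _ (Finset.mem_image_of_mem _ (by simp [hj, hjt]))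
  · have := mul_nonneg (sub_nonneg.2 ht) (speed_nonneg h.valid k hs j)
    linarith
  · rcases (speed_nonneg h.valid k hs j).eq_or_lt with h0 | h0
    · rw [← h0]; simpa using hy
    · have h1 := hlt _ (Finset.mem_union_right _ (Finset.mem_image_of_mem
        (fun j => τ + (I.size j - y j) / speed I k s Q j)
        (by simp [hj, h0, hy] : j ∈ I.jobs.filter fun j => y j < I.size j ∧ 0 < speed I k s Q j)))
      have h2 : t - τ < (I.size j - y j) / speed I k s Q j := by linarith
      rw [lt_div_iff₀ h0] at h2
      linarith

lemma integral_speed_const {I : Instance m} {k : ℕ} {s τ t : ℝ} {q : ℝ → Queues m} {Q : Queues m}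
    (ht : τ ≤ t) (h : ∀ u, τ < u → u < t → q u = Q) (j : ℕ) :
    ∫ u in τ..t, speed I k s (q u) j = (t - τ) * speed I k s Q j := by
  rw [intervalIntegral.integral_congr_Ioo_of_le (g := fun _ => speed I k s Q j) ht
    fun u hu => by simp only [h u hu.1 hu.2]]
  simp

lemma Settled.trajectory_of_no_events {I : Instance m} {k : ℕ} {s θ τ : ℝ} (hs : 0 ≤ s)
    {y : ℕ → ℝ} {Q : Queues m} (h : Settled I θ τ y Q) (he : nextEvents I k s τ y Q = ∅) :
    Trajectory I k s θ τ y fun _ => Q := by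
  have hset : ∀ t, τ ≤ t → Settled I θ t (fun j => y j + ∫ _ in τ..t, speed I k s Q j) Q := by
    intro t ht
    simp only [integral_speed_const (q := fun _ => Q) ht fun _ _ _ => rfl]
    exact h.advance_of_lt_nextEvents hs ht (by simp [he])
  refine ⟨fun t => .of_forall fun _ => rfl, hset, fun t ht => ⟨Q, .of_forall fun _ => rfl, ?_⟩⟩
  rw [unfinished_eq_self fun i j hj => (((hset t ht.le).mem_iff j).1 ⟨i, hj⟩).2.2]
  refine (settle_eq_self h.nash fun j hj hjt => ?_).symm
  have : I.release j ∈ nextEvents I k s τ y Q :=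
    Finset.mem_union_left _ (Finset.mem_image_of_mem _ (by simp [hj, hjt, ht]))
  simp [he] at this

/-- The queues stay constant up to the next event `τ'`, where `settle` restarts the process with the
updated work. Integrals split at `τ'`, so the three properties of a trajectory carry over from the
two pieces. -/
lemma Trajectory.glue {I : Instance m} {k : ℕ} {s θ τ τ' : ℝ} (hs : 0 ≤ s) {y : ℕ → ℝ}
    {Q : Queues m} {q : ℝ → Queues m} (h : Settled I θ τ y Q) (hτ : τ < τ')
    (hmin : ∀ u ∈ nextEvents I k s τ y Q, τ' ≤ u)
    (hq0 : q τ' = UnrelatedMachines.settle I τ' θ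
      (unfinished I (fun j => y j + (τ' - τ) * speed I k s Q j) Q))
    (hv : ∀ t, Valid I (q t))
    (hq : Trajectory I k s θ τ' (fun j => y j + (τ' - τ) * speed I k s Q j) q) :
    Trajectory I k s θ τ y fun t => if t < τ' then Q else q t := by
  set p : ℝ → Queues m := fun t => if t < τ' then Q else q t with hp
  have hp1 : ∀ t, t < τ' → p t = Q := fun t ht => by simp [hp, ht]
  have hp2 : ∀ t, τ' ≤ t → p t = q t := fun t ht => by simp [hp, not_lt.2 ht]
  have hright : ∀ t, ∀ᶠ u in 𝓝[>] t, p u = p t := by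
    intro t
    rcases lt_or_ge t τ' with ht | ht
    · filter_upwards [Ioo_mem_nhdsGT ht] with u hu
      rw [hp1 u hu.2, hp1 t ht]
    · filter_upwards [hq.right t, self_mem_nhdsWithin] with u hu hut
      rw [hp2 u (ht.trans (le_of_lt hut)), hp2 t ht, hu]
  have hpv : ∀ t, Valid I (p t) := by
    intro t
    rcases lt_or_ge t τ' with ht | ht
    · rw [hp1 t ht]; exact h.valid
    · rw [hp2 t ht]; exact hv t
  have hw1 : ∀ t, τ ≤ t → t ≤ τ' → ∀ j,
      ∫ u in τ..t, speed I k s (p u) j = (t - τ) * speed I k s Q j :=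
    fun t ht ht' j => integral_speed_const ht (fun u _ hu => hp1 u (hu.trans_le ht')) j
  have hw2 : ∀ t, τ' ≤ t → (fun j => y j + ∫ u in τ..t, speed I k s (p u) j) =
      fun j => (y j + (τ' - τ) * speed I k s Q j) + ∫ u in τ'..t, speed I k s (q u) j := by
    intro t ht
    funext j
    have hi := intervalIntegrable_speed (k := k) hs hright hpv j
    rw [← intervalIntegral.integral_add_adjacent_intervals (hi τ τ') (hi τ' t),
      hw1 τ' hτ.le le_rfl, intervalIntegral.integral_congr_Ioo_of_le
        (g := fun u => speed I k s (q u) j) ht fun u hu => by simp only [hp2 u hu.1.le]]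
    ring
  have hset : ∀ t, τ ≤ t →
      Settled I θ t (fun j => y j + ∫ u in τ..t, speed I k s (p u) j) (p t) := by
    intro t ht
    rcases lt_or_ge t τ' with ht' | ht'
    · simp only [hw1 t ht ht'.le, hp1 t ht']
      exact h.advance_of_lt_nextEvents hs ht fun u hu => ht'.trans_le (hmin u hu)
    · rw [hw2 t ht', hp2 t ht']
      exact hq.settled t ht'
  refine ⟨hright, hset, fun t ht => ?_⟩
  rcases lt_trichotomy t τ' with ht' | rfl | ht'
  · refine ⟨Q, ?_, ?_⟩
    · filter_upwards [self_mem_nhdsWithin] with u hu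
      exact hp1 u (lt_trans hu ht')
    · have h1 := hset t ht.le
      rw [hp1 t ht'] at h1 ⊢
      rw [unfinished_eq_self fun i j hj => ((h1.mem_iff j).1 ⟨i, hj⟩).2.2]
      refine (settle_eq_self h.nash fun j hj hjt => ?_).symm
      refine absurd (hmin t ?_) (not_le.2 ht')
      exact hjt ▸ Finset.mem_union_left _ (Finset.mem_image_of_mem _ (by simp [hj, hjt, ht]))
  · refine ⟨Q, ?_, ?_⟩
    · filter_upwards [self_mem_nhdsWithin] with u hu
      exact hp1 u hu
    · simp only [hw1 t ht.le le_rfl, hp2 t le_rfl, hq0]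
  · obtain ⟨Q₀, h1, h2⟩ := hq.left t ht'
    refine ⟨Q₀, ?_, ?_⟩
    · filter_upwards [h1, Ioo_mem_nhdsLT ht'] with u hu hu'
      rw [hp2 u hu'.1.le, hu]
    · rw [hw2 t ht'.le, hp2 t ht'.le, h2]

/-- The number of future releases plus the number of unfinished jobs drops at every event, so
finitely many gluings suffice. -/
lemma exists_trajectory_of_card (hm : 0 < m) (I : Instance m) (k : ℕ) {s θ : ℝ} (hs : 0 ≤ s)
    (hθ : 0 ≤ θ) (N : ℕ) : ∀ (τ : ℝ) (Q : Queues m) (y : ℕ → ℝ), Settled I θ τ y Q →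
    (∀ j ∈ I.jobs, τ < I.release j → y j = 0) →
    (I.jobs.filter fun j => τ < I.release j).card +
      (I.jobs.filter fun j => y j < I.size j).card ≤ N →
    ∃ q : ℝ → Queues m, (∀ t ≤ τ, q t = Q) ∧ (∀ t, Valid I (q t)) ∧
      Trajectory I k s θ τ y q := by
  induction N with
  | zero =>
    intro τ Q y h h0 hN
    refine ⟨fun _ => Q, fun _ _ => rfl, fun _ => h.valid, h.trajectory_of_no_events hs ?_⟩
    have h1 : (I.jobs.filter fun j => τ < I.release j) = ∅ := by
      rw [← Finset.card_eq_zero]; omega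
    have h2 : (I.jobs.filter fun j => y j < I.size j) = ∅ := by
      rw [← Finset.card_eq_zero]; omega
    rw [Finset.filter_eq_empty_iff] at h2
    rw [nextEvents, h1, Finset.filter_eq_empty_iff.2 fun j hj h' => h2 hj h'.1]
    simp
  | succ N ih =>
    intro τ Q y h h0 hN
    by_cases he : nextEvents I k s τ y Q = ∅
    · exact ⟨fun _ => Q, fun _ _ => rfl, fun _ => h.valid, h.trajectory_of_no_events hs he⟩
    have hne := Finset.nonempty_iff_ne_empty.2 he
    -- At the earliest event either a release leaves the first counted set or a completed job leaves
    -- the second.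
    set τ' := (nextEvents I k s τ y Q).min' hne with hτ'
    have hmem : τ' ∈ nextEvents I k s τ y Q := Finset.min'_mem _ _
    have hmin : ∀ u ∈ nextEvents I k s τ y Q, τ' ≤ u := fun u hu => Finset.min'_le _ _ hu
    clear_value τ'
    have hτ : τ < τ' := lt_of_mem_nextEvents hmem
    set z : ℕ → ℝ := fun j => y j + (τ' - τ) * speed I k s Q j with hz
    have hyz : ∀ j, y j ≤ z j := fun j => by
      have := mul_nonneg (sub_nonneg.2 hτ.le) (speed_nonneg h.valid k hs j)
      simp only [hz]; linarith
    have hz0 : ∀ j ∈ I.jobs, τ < I.release j → z j = 0 := fun j hj hjt => by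
      have hn : ∀ i, j ∉ Q i := fun i hi =>
        absurd ((h.mem_iff j).1 ⟨i, hi⟩).2.1 (not_le.2 hjt)
      simp [hz, h0 j hj hjt, speed_eq_zero I k s hn]
    have hset := h.settle hm hθ hτ (fun j hj hjt => hmin _ (Finset.mem_union_left _
      (Finset.mem_image_of_mem _ (by simp [hj, hjt])))) hyz hz0
    have hsub1 : (I.jobs.filter fun j => τ' < I.release j) ⊆
        I.jobs.filter fun j => τ < I.release j :=
      Finset.monotone_filter_right _ fun j _ hj => hτ.trans hj
    have hsub2 : (I.jobs.filter fun j => z j < I.size j) ⊆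
        I.jobs.filter fun j => y j < I.size j :=
      Finset.monotone_filter_right _ fun j _ hj => (hyz j).trans_lt hj
    have hcard : (I.jobs.filter fun j => τ' < I.release j).card +
        (I.jobs.filter fun j => z j < I.size j).card ≤ N := by
      have hc1 := Finset.card_le_card hsub1
      have hc2 := Finset.card_le_card hsub2
      simp only [nextEvents, Finset.mem_union, Finset.mem_image] at hmem
      rcases hmem with ⟨j, hj, hjt⟩ | ⟨j, hj, hjt⟩
      · have := Finset.card_lt_card (Finset.ssubset_iff_subset_ne.2 ⟨hsub1, fun heq => by
          rw [← heq] at hj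
          simp [hjt] at hj⟩)
        omega
      · rw [Finset.mem_filter] at hj
        have hzj : z j = I.size j := by
          simp only [hz, ← hjt]
          field_simp [hj.2.2.ne']
          ring
        have := Finset.card_lt_card (Finset.ssubset_iff_subset_ne.2 ⟨hsub2, fun heq => by
          have hj' : j ∈ I.jobs.filter fun j => y j < I.size j := by simp [hj.1, hj.2.1]
          rw [← heq] at hj'
          simp [hzj] at hj'⟩)
        omega
    obtain ⟨q, hq0, hqv, hq⟩ := ih τ' _ z hset
      (fun j hj hjt => hz0 j hj (hτ.trans hjt)) hcard
    refine ⟨fun t => if t < τ' then Q else q t, fun t ht => by simp [ht.trans_lt hτ],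
      fun t => ?_, Trajectory.glue hs h hτ hmin (hq0 τ' le_rfl) hqv hq⟩
    dsimp only
    split_ifs
    · exact h.valid
    · exact hqv t

lemma valid_empty (I : Instance m) : Valid I fun _ => [] :=
  ⟨by simp, by simp, by simp⟩

lemma isNash_empty (I : Instance m) (θ : ℝ) : IsNash I θ fun _ => [] :=
  fun j i d hp => by simpa using hp.1

lemma settled_empty (I : Instance m) (θ : ℝ) {t : ℝ} (ht : t < 0) (Y : ℕ → ℝ) :
    Settled I θ t Y fun _ => [] := by
  refine ⟨valid_empty I, isNash_empty I θ, fun j => ?_⟩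
  simp only [List.not_mem_nil, exists_false, false_iff, not_and]
  intro hj hjt
  linarith [I.release_nonneg j hj]

/-- A run of the queues over all times, starting from the empty queues at time `-1`. -/
lemma exists_trajectory (hm : 0 < m) (I : Instance m) (k : ℕ) {s θ : ℝ} (hs : 0 ≤ s)
    (hθ : 0 ≤ θ) : ∃ q : ℝ → Queues m, (∀ t ≤ -1, q t = fun _ => []) ∧ (∀ t, Valid I (q t)) ∧
      Trajectory I k s θ (-1) (fun _ => 0) q :=
  exists_trajectory_of_card hm I k hs hθ _ (-1) _ _ (settled_empty I θ (by norm_num) _)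
    (fun _ _ _ => rfl) le_rfl


/-! ### The algorithm -/

/-- `S` is the run of SelfishMigrate with queues `Q` in which all choices are made by
`settle`. -/
structure IsSettledRun (k : ℕ) (s θ : ℝ) (I : Instance m) (S : Schedule m) (Q : ℝ → Queues m) :
    Prop where
  mem_iff : ∀ t i j, j ∈ Q t i ↔ Active I S j t ∧ S.mach j t = i
  nodup : ∀ t i, (Q t i).Nodup
  power : ∀ t i, ∀ j ∈ Q t i, S.power j t = share I k s (Q t i) j
  power_zero : ∀ t j, ¬ Active I S j t → S.power j t = 0
  measurable_mach : ∀ j, Measurable (S.mach j)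
  measurable_power : ∀ j, Measurable (S.power j)
  right : ∀ t, ∀ᶠ u in 𝓝[>] t, Q u = Q t
  left : ∀ t, ∃ Q₀ : Queues m, (∀ᶠ u in 𝓝[<] t, Q u = Q₀) ∧
    Q t = settle I t θ (depart I S t Q₀)
  nash : ∀ t, IsNash I θ (Q t)

open Classical in
/-- The schedule determined by a trajectory of the queues. -/
noncomputable def scheduleOf (hm : 0 < m) (I : Instance m) (k : ℕ) (s : ℝ) (q : ℝ → Queues m) :
    Schedule m where
  mach j t := if h : ∃ i, j ∈ q t i then h.choose else ⟨0, hm⟩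
  power j t := if h : ∃ i, j ∈ q t i then share I k s (q t h.choose) j else 0

lemma scheduleOf_mach (hm : 0 < m) {I : Instance m} (k : ℕ) (s : ℝ) {q : ℝ → Queues m} {t : ℝ}
    (hv : Valid I (q t)) {i : Fin m} {j : ℕ} (hj : j ∈ q t i) :
    (scheduleOf hm I k s q).mach j t = i := by
  have h : ∃ i, j ∈ q t i := ⟨i, hj⟩
  simp only [scheduleOf, dif_pos h]
  exact hv.disjoint _ _ _ h.choose_spec hj

lemma scheduleOf_power (hm : 0 < m) {I : Instance m} (k : ℕ) (s : ℝ) {q : ℝ → Queues m} {t : ℝ}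
    (hv : Valid I (q t)) {i : Fin m} {j : ℕ} (hj : j ∈ q t i) :
    (scheduleOf hm I k s q).power j t = share I k s (q t i) j := by
  have h : ∃ i, j ∈ q t i := ⟨i, hj⟩
  simp only [scheduleOf, dif_pos h]
  rw [hv.disjoint _ _ _ h.choose_spec hj]

lemma scheduleOf_power_eq_zero (hm : 0 < m) {I : Instance m} (k : ℕ) (s : ℝ) {q : ℝ → Queues m}
    {t : ℝ} {j : ℕ} (hj : ¬ ∃ i, j ∈ q t i) : (scheduleOf hm I k s q).power j t = 0 := by
  simp only [scheduleOf, dif_neg hj]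

lemma scheduleOf_rate_mul_power (hm : 0 < m) {I : Instance m} (k : ℕ) (s : ℝ) {q : ℝ → Queues m}
    {t : ℝ} (hv : Valid I (q t)) (j : ℕ) :
    I.rate ((scheduleOf hm I k s q).mach j t) j * (scheduleOf hm I k s q).power j t =
      speed I k s (q t) j := by
  by_cases hj : ∃ i, j ∈ q t i
  · obtain ⟨i, hi⟩ := hj
    rw [scheduleOf_mach hm k s hv hi, scheduleOf_power hm k s hv hi, speed_eq hv k s hi]
  · rw [scheduleOf_power_eq_zero hm k s hj, speed_eq_zero I k s (by simpa using hj), mul_zero]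

lemma exists_isSettledRun (hm : 0 < m) (I : Instance m) (k : ℕ) {s θ : ℝ} (hs : 0 ≤ s)
    (hθ : 0 ≤ θ) : ∃ S Q, IsSettledRun k s θ I S Q := by
  obtain ⟨q, hq0, hv, hq⟩ := exists_trajectory hm I k hs hθ
  set S := scheduleOf hm I k s q with hS
  set Y : ℝ → ℕ → ℝ := fun t j => 0 + ∫ u in (-1 : ℝ)..t, speed I k s (q u) j with hY
  have hrel : ∀ t i, ∀ j ∈ q t i, j ∈ I.jobs ∧ I.release j ≤ t := by
    intro t i j hj
    rcases le_or_gt t (-1) with ht | ht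
    · simp [hq0 t ht] at hj
    · have := ((hq.settled t ht.le).mem_iff j).1 ⟨i, hj⟩
      exact ⟨this.1, this.2.1⟩
  -- A job is in no queue before its release, so integrating from `-1` or from the release time
  -- gives the same work.
  have hwork : ∀ j ∈ I.jobs, ∀ t, work I S j t = Y t j := by
    intro j hj t
    have hi := intervalIntegrable_speed (k := k) hs hq.right hv j
    have h1 : work I S j t = ∫ u in (I.release j)..t, speed I k s (q u) j := by
      simp only [work, hS, scheduleOf_rate_mul_power hm k s (hv _)]
    have h2 : ∫ u in (-1 : ℝ)..(I.release j), speed I k s (q u) j = 0 := by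
      rw [intervalIntegral.integral_congr_Ioo_of_le (g := fun _ => 0)
        (by linarith [I.release_nonneg j hj]) fun u hu => ?_]
      · simp
      · exact speed_eq_zero I k s fun i hi => absurd (hrel u i j hi).2 (not_le.2 hu.2)
    simp only [hY]
    rw [h1, ← intervalIntegral.integral_add_adjacent_intervals (hi (-1) (I.release j)) (hi _ t),
      h2, zero_add, zero_add]
  have hdone : ∀ j ∈ I.jobs, ∀ t, I.release j ≤ t → (¬ Done I S j t ↔ Y t j < I.size j) := by
    intro j hj t ht
    simp [Done, ht, hwork j hj]
  have hact : ∀ t j, Active I S j t ↔ ∃ i, j ∈ q t i := by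
    intro t j
    rcases le_or_gt t (-1) with ht | ht
    · simp only [hq0 t ht, List.not_mem_nil, exists_false, iff_false]
      rintro ⟨hj, hjt, -⟩
      linarith [I.release_nonneg j hj]
    · rw [(hq.settled t ht.le).mem_iff j, Active]
      refine and_congr_right fun hj => and_congr_right fun hjt => hdone j hj t hjt
  refine ⟨S, q, fun t i j => ?_, fun t => (hv t).nodup,
    fun t i j hj => scheduleOf_power hm k s (hv t) hj,
    fun t j hj => scheduleOf_power_eq_zero hm k s fun h => hj ((hact t j).2 h),
    fun j => ?_, fun j => ?_, hq.right, fun t => ?_, fun t => ?_⟩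
  · rw [hact]
    constructor
    · exact fun hj => ⟨⟨i, hj⟩, scheduleOf_mach hm k s (hv t) hj⟩
    · rintro ⟨⟨i', hi'⟩, h⟩
      rw [scheduleOf_mach hm k s (hv t) hi'] at h
      exact h ▸ hi'
  · refine measurable_of_eventually_eq fun t => (hq.right t).mono fun u hu => ?_
    simp only [hS, scheduleOf, hu]
  · refine measurable_of_eventually_eq fun t => (hq.right t).mono fun u hu => ?_
    simp only [hS, scheduleOf, hu]
  · rcases le_or_gt t (-1) with ht | ht
    · refine ⟨fun _ => [], ?_, ?_⟩
      · filter_upwards [self_mem_nhdsWithin] with u hu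
        exact hq0 u ((le_of_lt hu).trans ht)
      · have : depart I S t (fun _ => []) = fun _ => [] := by
          funext i; simp [depart]
        rw [this, hq0 t ht, settle_eq_self (isNash_empty I θ)]
        intro j hj hjt
        linarith [I.release_nonneg j hj]
    · obtain ⟨Q₀, h1, h2⟩ := hq.left t ht
      refine ⟨Q₀, h1, h2.trans ?_⟩
      obtain ⟨u, hu, hut⟩ := (h1.and self_mem_nhdsWithin).exists
      rw [depart_eq_unfinished fun i j hj => ?_]
      have hj' := hrel u i j (hu ▸ hj)
      exact hdone j hj'.1 t (hj'.2.trans (le_of_lt hut))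
  · rcases le_or_gt t (-1) with ht | ht
    · rw [hq0 t ht]; exact isNash_empty I θ
    · exact (hq.settled t ht.le).nash

namespace IsSettledRun

variable {k : ℕ} {s θ : ℝ} {I : Instance m} {S : Schedule m} {Q : ℝ → Queues m}

lemma valid (h : IsSettledRun k s θ I S Q) (t : ℝ) : Valid I (Q t) where
  mem_jobs i j hj := ((h.mem_iff t i j).1 hj).1.1
  nodup := h.nodup t
  disjoint i i' j hj hj' :=
    ((h.mem_iff t i j).1 hj).2.symm.trans ((h.mem_iff t i' j).1 hj').2

lemma released (h : IsSettledRun k s θ I S Q) (t : ℝ) : Released I t (Q t) :=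
  fun i j hj => ⟨((h.mem_iff t i j).1 hj).1.1, ((h.mem_iff t i j).1 hj).1.2.1⟩

/-- The queues just before time `t` hold released jobs only. -/
lemma left' (h : IsSettledRun k s θ I S Q) (t : ℝ) : ∃ Q₀ : Queues m,
    (∀ᶠ u in 𝓝[<] t, Q u = Q₀) ∧ Valid I Q₀ ∧ Released I t Q₀ ∧
    Q t = settle I t θ (depart I S t Q₀) := by
  obtain ⟨Q₀, h1, h2⟩ := h.left t
  obtain ⟨u, hu, hut⟩ := (h1.and self_mem_nhdsWithin).exists
  refine ⟨Q₀, h1, hu ▸ h.valid u, fun i j hj => ?_, h2⟩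
  have := h.released u i j (hu ▸ hj)
  exact ⟨this.1, this.2.trans (le_of_lt hut)⟩

lemma eq_empty (h : IsSettledRun k s θ I S Q) {t : ℝ} (ht : t < 0) : Q t = fun _ => [] := by
  funext i
  refine List.eq_nil_iff_forall_not_mem.2 fun j hj => ?_
  have := h.released t i j hj
  linarith [I.release_nonneg j this.1]

lemma isSelfishMigrate (hm : 0 < m) (h : IsSettledRun k s θ I S Q) :
    IsSelfishMigrate k s θ I S := by
  refine ⟨Q, h.mem_iff, h.nodup, h.power, h.right, fun t => ?_, h.nash⟩
  obtain ⟨Q₀, h1, hv, -, h2⟩ := h.left' t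
  refine ⟨Q₀, h1, ?_⟩
  rw [h2]
  exact (isOutcome_settle hm (hv.of_sublist (depart_sublist I S t Q₀))).1

lemma power_nonneg (h : IsSettledRun k s θ I S Q) (hs : 0 ≤ s) (j : ℕ) (t : ℝ) :
    0 ≤ S.power j t := by
  by_cases hj : Active I S j t
  · have hm := (h.mem_iff t _ j).2 ⟨hj, rfl⟩
    rw [h.power t _ j hm]
    exact share_nonneg (h.valid t) k hs hm
  · exact (h.power_zero t j hj).ge

lemma feasible (h : IsSettledRun k s θ I S Q) (hs : 0 ≤ s) : Feasible s I S where
  measurable_mach j _ := h.measurable_mach j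
  measurable_power j _ := h.measurable_power j
  power_nonneg j _ t := h.power_nonneg hs j t
  power_sum_le i t := by
    refine le_trans (le_of_eq ?_) (sum_share_le (h.valid t) k hs i)
    rw [← Finset.sum_congr rfl fun j hj => h.power t i j (by simpa using hj)]
    symm
    refine Finset.sum_subset (fun j hj => ?_) fun j hj hn => ?_
    · have := (h.mem_iff t i j).1 (by simpa using hj)
      simp [this.1.1, this.2]
    · rw [Finset.mem_filter] at hj
      refine h.power_zero t j fun ha => hn ?_
      simpa using (h.mem_iff t i j).2 ⟨ha, hj.2⟩

end IsSettledRun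

/-! ### Non-clairvoyance: equal histories give equal queues -/

lemma SameHistory.agree {I₁ I₂ : Instance m} {S₁ S₂ : Schedule m} {t : ℝ}
    (h : SameHistory I₁ S₁ I₂ S₂ t) : Agree I₁ I₂ t :=
  ⟨h.1, fun j hj ht => ⟨(h.2 j hj ht).1, (h.2 j hj ht).2.1, (h.2 j hj ht).2.2.1⟩⟩

/-- Settled runs with the same history have the same queues. -/
lemma IsSettledRun.queues_eq {k : ℕ} {s θ : ℝ} {I₁ I₂ : Instance m} {S₁ S₂ : Schedule m}
    {Q₁ Q₂ : ℝ → Queues m} (h₁ : IsSettledRun k s θ I₁ S₁ Q₁) (h₂ : IsSettledRun k s θ I₂ S₂ Q₂)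
    {t : ℝ} (h : SameHistory I₁ S₁ I₂ S₂ t) : Q₁ t = Q₂ t := by
  -- The induction starts at a negative time, when both families of queues are empty, and propagates
  -- "equal earlier implies equal later" on the pair of runs.
  have ha : min t (-1) < 0 := (min_le_right _ _).trans_lt (by norm_num)
  refine rel_of_eventually (fun u => (Q₁ u, Q₂ u)) (fun x y => x.1 = x.2 → y.1 = y.2)
    (fun _ h => h) (fun _ _ _ h h' => h' ∘ h) (min_le_left t (-1)) (fun u _ _ => ?_)
    (fun u _ hu => ?_) (by simp only [h₁.eq_empty ha, h₂.eq_empty ha])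
  · filter_upwards [h₁.right u, h₂.right u] with v h1 h2 heq
    simpa only [h1, h2] using heq
  · obtain ⟨P₁, hP₁, -, hr, hs₁⟩ := h₁.left' u
    obtain ⟨P₂, hP₂, -, -, hs₂⟩ := h₂.left' u
    filter_upwards [hP₁, hP₂] with v h1 h2 heq
    simp only [h1, h2] at heq
    subst heq
    -- The completions observed up to `t` decide which jobs depart, and they agree by hypothesis.
    have hd : depart I₁ S₁ u P₁ = depart I₂ S₂ u P₁ := by
      classical
      funext i
      refine List.filter_congr fun j hj => decide_eq_decide.2 (not_congr ?_)
      have hj' := hr i j hj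
      exact (h.2 j hj'.1 (hj'.2.trans hu)).2.2.2 u hu
    change Q₁ u = Q₂ u
    rw [hs₁, hs₂, ← hd]
    exact (h.agree.mono hu).settle_eq θ fun i j hj =>
      hr i j ((depart_sublist I₁ S₁ u P₁ i).subset hj)

lemma IsSettledRun.causal {k : ℕ} {s θ : ℝ} {I₁ I₂ : Instance m} {S₁ S₂ : Schedule m}
    {Q₁ Q₂ : ℝ → Queues m} (h₁ : IsSettledRun k s θ I₁ S₁ Q₁) (h₂ : IsSettledRun k s θ I₂ S₂ Q₂)
    {t : ℝ} (h : SameHistory I₁ S₁ I₂ S₂ t) {j : ℕ} (hj : Active I₁ S₁ j t) :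
    S₁.mach j t = S₂.mach j t ∧ S₁.power j t = S₂.power j t := by
  have heq := h₁.queues_eq h₂ h
  have hm₁ := (h₁.mem_iff t _ j).2 ⟨hj, rfl⟩
  have hm₂ := heq ▸ hm₁
  refine ⟨((h₂.mem_iff t _ j).1 hm₂).2.symm, ?_⟩
  rw [h₁.power t _ j hm₁, h₂.power t _ j hm₂, ← heq]
  exact h.agree.share_eq k s (h₁.released t _) hm₁


/-! ### Work in a feasible schedule -/

lemma measurable_select {M : ℝ → Fin m} (hM : Measurable M) {β : Fin m → ℝ → ℝ}
    (hβ : ∀ i, Measurable (β i)) : Measurable fun u => β (M u) u := by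
  have : (fun u => β (M u) u) = fun u => ∑ i, if M u = i then β i u else 0 := by
    funext u; simp
  rw [this]
  exact Finset.measurable_sum _ fun i _ =>
    Measurable.ite (hM (measurableSet_singleton i)) (hβ i) measurable_const

namespace Feasible

variable {s : ℝ} {I : Instance m} {S : Schedule m}

lemma power_le (h : Feasible s I S) {j : ℕ} (hj : j ∈ I.jobs) (t : ℝ) : S.power j t ≤ s :=
  (Finset.single_le_sum (f := fun j => S.power j t)
    (fun j' hj' => h.power_nonneg j' (Finset.mem_filter.1 hj').1 t)
    (by simp [hj] : j ∈ I.jobs.filter fun j' => S.mach j' t = S.mach j t)).trans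
    (h.power_sum_le (S.mach j t) t)

lemma intervalIntegrable_select (h : Feasible s I S) {j : ℕ} (hj : j ∈ I.jobs)
    {β : Fin m → ℝ → ℝ} (hβ : ∀ i, Measurable (β i)) {B : ℝ} (hB : ∀ i t, |β i t| ≤ B)
    (a b : ℝ) : IntervalIntegrable (fun u => β (S.mach j u) u * S.power j u)
      MeasureTheory.volume a b := by
  refine intervalIntegrable_of_bounded ((measurable_select (h.measurable_mach j hj) hβ).mul
    (h.measurable_power j hj)) (B * s) (fun t => ?_) a b
  rw [Pi.mul_apply, abs_mul, abs_of_nonneg (h.power_nonneg j hj t)]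
  exact mul_le_mul (hB _ t) (h.power_le hj t) (h.power_nonneg j hj t)
    ((abs_nonneg _).trans (hB (S.mach j t) t))

lemma intervalIntegrable_power (h : Feasible s I S) {j : ℕ} (hj : j ∈ I.jobs) (a b : ℝ) :
    IntervalIntegrable (S.power j) MeasureTheory.volume a b := by
  simpa using h.intervalIntegrable_select hj (β := fun _ _ => 1) (fun _ => measurable_const)
    (B := 1) (by simp) a b

lemma intervalIntegrable_rate (h : Feasible s I S) {j : ℕ} (hj : j ∈ I.jobs) (a b : ℝ) :
    IntervalIntegrable (fun u => I.rate (S.mach j u) j * S.power j u)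
      MeasureTheory.volume a b :=
  h.intervalIntegrable_select hj (β := fun i _ => I.rate i j) (fun _ => measurable_const)
    (B := ∑ i, |I.rate i j|) (fun i _ => Finset.single_le_sum (f := fun i => |I.rate i j|)
      (fun _ _ => abs_nonneg _) (Finset.mem_univ i)) a b

lemma work_mono (h : Feasible s I S) {j : ℕ} (hj : j ∈ I.jobs) {t u : ℝ} (htu : t ≤ u) :
    work I S j t ≤ work I S j u := by
  have hi := h.intervalIntegrable_rate hj
  rw [work, work, ← intervalIntegral.integral_add_adjacent_intervals (hi _ t) (hi t u)]
  linarith [intervalIntegral.integral_nonneg_of_forall (μ := MeasureTheory.volume) htu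
    (fun v => mul_nonneg (I.rate_nonneg (S.mach j v) j hj) (h.power_nonneg j hj v))]

lemma done_mono (h : Feasible s I S) {j : ℕ} (hj : j ∈ I.jobs) {t u : ℝ} (htu : t ≤ u)
    (hd : Done I S j t) : Done I S j u :=
  ⟨hd.1.trans htu, hd.2.trans (h.work_mono hj htu)⟩

/-- A dual constraint, integrated along a schedule that completes the job by time `D`. -/
lemma le_of_dual_constraint (h : Feasible 1 I S) {j : ℕ} (hj : j ∈ I.jobs) {D : ℝ}
    (hD : Done I S j D) {α : ℝ} {β : Fin m → ℝ → ℝ} (hβm : ∀ i, Measurable (β i))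
    (hβ : ∀ i t, 0 ≤ β i t) {B : ℝ} (hB : ∀ i t, β i t ≤ B)
    (hc : ∀ t, I.release j ≤ t → ∀ i, α * I.rate i j ≤
      I.weight j * (t - I.release j) * I.rate i j + (β i t + I.weight j) * I.size j) :
    α ≤ 2 * (I.weight j * (D - I.release j)) +
      ∫ u in (I.release j)..D, β (S.mach j u) u * S.power j u := by
  set r := I.release j
  set w := I.weight j
  set X := work I S j D with hX
  have hrD : r ≤ D := hD.1
  have hp := I.size_pos j hj
  have hw : 0 < w := I.weight_pos j hj
  have hXp : I.size j ≤ X := hD.2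
  have hi1 := h.intervalIntegrable_rate hj r D
  have hi2 := h.intervalIntegrable_power hj r D
  have hi3 := h.intervalIntegrable_select hj hβm (B := B)
    (fun i t => by rw [abs_of_nonneg (hβ i t)]; exact hB i t) r D
  set Z := ∫ u in r..D, β (S.mach j u) u * S.power j u with hZ
  have hZ0 : 0 ≤ Z := intervalIntegral.integral_nonneg_of_forall hrD
    fun u => mul_nonneg (hβ _ u) (h.power_nonneg j hj u)
  set V := ∫ u in r..D, S.power j u with hV
  have hV0 : 0 ≤ V := intervalIntegral.integral_nonneg_of_forall hrD
    fun u => h.power_nonneg j hj u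
  have hV1 : V ≤ D - r := by
    have := intervalIntegral.integral_mono hrD hi2 (intervalIntegrable_const (c := (1 : ℝ)))
      fun u => h.power_le hj u
    simpa using this
  -- The constraint on the machine in use is multiplied by the processing power and integrated over
  -- the flow-time of the job.
  have key : α * X ≤ w * (D - r) * X + I.size j * (Z + w * V) := by
    rw [hX, hZ, hV, work, ← intervalIntegral.integral_const_mul,
      ← intervalIntegral.integral_const_mul, ← intervalIntegral.integral_const_mul,
      ← intervalIntegral.integral_add hi3 (hi2.const_mul w),
      ← intervalIntegral.integral_const_mul,
      ← intervalIntegral.integral_add (hi1.const_mul _) ((hi3.add (hi2.const_mul w)).const_mul _)]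
    refine intervalIntegral.integral_mono_on hrD (hi1.const_mul _)
      ((hi1.const_mul _).add ((hi3.add (hi2.const_mul w)).const_mul _)) fun u hu => ?_
    have hν := h.power_nonneg j hj u
    have hℓ := I.rate_nonneg (S.mach j u) j hj
    have h1 := mul_le_mul_of_nonneg_right (hc u hu.1 (S.mach j u)) hν
    have h2 : w * (u - r) * (I.rate (S.mach j u) j * S.power j u) ≤
        w * (D - r) * (I.rate (S.mach j u) j * S.power j u) :=
      mul_le_mul_of_nonneg_right (mul_le_mul_of_nonneg_left (by linarith [hu.2]) hw.le)
        (mul_nonneg hℓ hν)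
    linarith
  have hXpos : 0 < X := hp.trans_le hXp
  -- Since at least the length is processed, `X` can replace it and be cancelled. The extra `w · V`
  -- is at most `w(D - r)` and is the source of the factor 2.
  have h3 : I.size j * (Z + w * V) ≤ X * (Z + w * V) :=
    mul_le_mul_of_nonneg_right hXp (by positivity)
  have h4 : α * X ≤ (w * (D - r) + (Z + w * V)) * X := by linarith
  have h5 := le_of_mul_le_mul_right h4 hXpos
  have h6 := mul_le_mul_of_nonneg_left hV1 hw.le
  linarith

/-- Weak duality: a feasible dual solution bounds the weighted flow-time of a schedule on machines
of unit speed from below, up to a factor of `2`. -/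
lemma weak_duality (h : Feasible 1 I S) {D : ℕ → ℝ} (hD : ∀ j ∈ I.jobs, Done I S j (D j))
    {α : ℕ → ℝ} {β : Fin m → ℝ → ℝ} (hβm : ∀ i, Measurable (β i))
    (hβ : ∀ i t, 0 ≤ β i t) {B : ℝ} (hB : ∀ i t, β i t ≤ B)
    (hc : ∀ j ∈ I.jobs, ∀ t, I.release j ≤ t → ∀ i, α j * I.rate i j ≤
      I.weight j * (t - I.release j) * I.rate i j + (β i t + I.weight j) * I.size j)
    {T : ℝ} (hT0 : 0 ≤ T) (hT : ∀ j ∈ I.jobs, D j ≤ T) :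
    ∑ j ∈ I.jobs, α j ≤ 2 * ∑ j ∈ I.jobs, I.weight j * (D j - I.release j) +
      ∫ u in (0 : ℝ)..T, ∑ i, β i u := by
  have hB' : ∀ i t, |β i t| ≤ B := fun i t => by rw [abs_of_nonneg (hβ i t)]; exact hB i t
  have hi : ∀ j ∈ I.jobs, ∀ a b, IntervalIntegrable
      (fun u => β (S.mach j u) u * S.power j u) MeasureTheory.volume a b :=
    fun j hj => h.intervalIntegrable_select hj hβm hB'
  have h0 : ∀ j ∈ I.jobs, ∀ u, 0 ≤ β (S.mach j u) u * S.power j u :=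
    fun j hj u => mul_nonneg (hβ _ u) (h.power_nonneg j hj u)
  have h1 : ∀ j ∈ I.jobs, α j ≤ 2 * (I.weight j * (D j - I.release j)) +
      ∫ u in (0 : ℝ)..T, β (S.mach j u) u * S.power j u := by
    intro j hj
    refine (h.le_of_dual_constraint hj (hD j hj) hβm hβ hB (hc j hj)).trans
      (add_le_add_right ?_ _)
    exact intervalIntegral.integral_mono_interval (I.release_nonneg j hj) (hD j hj).1 (hT j hj)
      (.of_forall (h0 j hj)) (hi j hj 0 T)
  have h2 : ∑ j ∈ I.jobs, ∫ u in (0 : ℝ)..T, β (S.mach j u) u * S.power j u ≤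
      ∫ u in (0 : ℝ)..T, ∑ i, β i u := by
    rw [← intervalIntegral.integral_finsetSum fun j hj => hi j hj 0 T]
    refine intervalIntegral.integral_mono hT0 ?_ ?_ fun u => ?_
    · simpa only [Finset.sum_fn] using
        IntervalIntegrable.sum I.jobs (fun j hj => hi j hj 0 T)
    · refine intervalIntegrable_of_bounded (Finset.measurable_sum _ fun i _ => hβm i)
        (∑ _ : Fin m, B) (fun t => ?_) 0 T
      rw [abs_of_nonneg (Finset.sum_nonneg fun i _ => hβ i t)]
      exact Finset.sum_le_sum fun i _ => hB i t
    · simp only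
      -- Grouping the jobs by machine: the powers on a machine of unit speed add up to at most 1.
      rw [← Finset.sum_fiberwise I.jobs fun j => S.mach j u]
      refine Finset.sum_le_sum fun i _ => ?_
      rw [Finset.sum_congr rfl (g := fun j => β i u * S.power j u)
        fun j hj => by rw [(Finset.mem_filter.1 hj).2], ← Finset.mul_sum]
      exact mul_le_of_le_one_right (hβ i u) (h.power_sum_le i u)
  calc ∑ j ∈ I.jobs, α j ≤ ∑ j ∈ I.jobs, (2 * (I.weight j * (D j - I.release j)) +
        ∫ u in (0 : ℝ)..T, β (S.mach j u) u * S.power j u) := Finset.sum_le_sum h1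
    _ ≤ _ := by
      rw [Finset.sum_add_distrib, ← Finset.mul_sum]
      exact add_le_add_right h2 _

end Feasible

/-! ### The loads of the jobs -/

/-- The convex function `x^(n+1)` lies above its tangent at `y`. This is the only inequality on
powers needed for both bounds on the loads. -/
lemma mul_pow_le_pow_add {x y : ℝ} (hx : 0 ≤ x) (hy : 0 ≤ y) (n : ℕ) :
    (n + 1) * x * y ^ n ≤ x ^ (n + 1) + n * y ^ (n + 1) := by
  induction n with
  | zero => simp
  | succ n ih =>
    have h1 := mul_le_mul_of_nonneg_right ih hx
    have h2 : 0 ≤ (n + 1) * y ^ n * (x - y) ^ 2 := by positivity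
    push_cast
    rw [pow_succ x (n + 1)]
    have h3 : y ^ (n + 1) = y ^ n * y := pow_succ _ _
    have h4 : y ^ (n + 1 + 1) = y ^ n * y * y := by rw [pow_succ, pow_succ]
    rw [h3] at h1 ⊢
    rw [h4]
    nlinarith

lemma pow_sub_pow_le {x w : ℝ} (hx : 0 ≤ x) (hw : 0 ≤ w) (k : ℕ) :
    (x + w) ^ (k + 1) - x ^ (k + 1) ≤ (k + 1) * w * (x + w) ^ k := by
  have := mul_pow_le_pow_add hx (add_nonneg hx hw) k
  rw [pow_succ (x + w)] at this ⊢
  linarith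

open Classical in
/-- The total weight up to job `j` in its queue, times the processing power of `j`. -/
noncomputable def load (I : Instance m) (k : ℕ) (s : ℝ) (Q : Queues m) (j : ℕ) : ℝ :=
  ∑ i, if j ∈ Q i then (weightAhead I (Q i) j + I.weight j) * share I k s (Q i) j else 0

lemma load_eq {I : Instance m} {Q : Queues m} (hQ : Valid I Q) (k : ℕ) (s : ℝ) {i : Fin m} {j : ℕ}
    (hj : j ∈ Q i) :
    load I k s Q j = (weightAhead I (Q i) j + I.weight j) * share I k s (Q i) j := by
  rw [load, Finset.sum_eq_single i]
  · simp [hj]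
  · intro i' _ hne
    rw [if_neg fun h => hne (hQ.disjoint _ _ _ h hj)]
  · simp

lemma load_eq_zero (I : Instance m) {Q : Queues m} (k : ℕ) (s : ℝ) {j : ℕ}
    (hj : ∀ i, j ∉ Q i) : load I k s Q j = 0 := by simp [load, hj]

lemma load_nonneg {I : Instance m} {Q : Queues m} (hQ : Valid I Q) (k : ℕ) {s : ℝ} (hs : 0 ≤ s)
    (j : ℕ) : 0 ≤ load I k s Q j := by
  by_cases hj : ∃ i, j ∈ Q i
  · obtain ⟨i, hi⟩ := hj
    rw [load_eq hQ k s hi]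
    exact mul_nonneg (add_nonneg (weightAhead_nonneg (hQ.weight_nonneg i) j)
      (hQ.weight_nonneg i j hi)) (share_nonneg hQ k hs hi)
  · rw [load_eq_zero I k s (by simpa using hj)]

/-- By convexity the power of `j` is at most `s(k+1)w(V+w)^k / W^(k+1)`; the factor `V + w`
completes the power `(V+w)^(k+1) ≤ W^(k+1)`. Hence no job's load exceeds a fixed multiple of its
weight, whatever its rank. -/
lemma load_le {I : Instance m} {Q : Queues m} (hQ : Valid I Q) (k : ℕ) {s : ℝ} (hs : 0 ≤ s)
    {j : ℕ} (hj : j ∈ I.jobs) : load I k s Q j ≤ s * (k + 1) * I.weight j := by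
  have hw := I.weight_pos j hj
  by_cases hj : ∃ i, j ∈ Q i
  · obtain ⟨i, hi⟩ := hj
    have hV := weightAhead_nonneg (hQ.weight_nonneg i) j
    have hT := hQ.totalWeight_pos hi
    have hle := weightAhead_add_le (hQ.weight_nonneg i) hi
    rw [load_eq hQ k s hi, share]
    set V := weightAhead I (Q i) j
    set w := I.weight j
    set W := totalWeight I (Q i)
    rw [← mul_div_assoc, div_le_iff₀ (by positivity)]
    have h1 := pow_sub_pow_le hV hw.le k
    have h2 : (V + w) ^ (k + 1) ≤ W ^ (k + 1) := pow_le_pow_left₀ (by linarith) hle _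
    calc (V + w) * (s * ((V + w) ^ (k + 1) - V ^ (k + 1)))
        ≤ (V + w) * (s * ((k + 1) * w * (V + w) ^ k)) := by gcongr
      _ = s * (k + 1) * w * (V + w) ^ (k + 1) := by ring
      _ ≤ _ := by gcongr
  · rw [load_eq_zero I k s (by simpa using hj)]
    positivity

/-- Each term dominates `(k+1)/(k+2)` times an increment of `x^(k+2)`, again by the tangent
inequality, and the increments telescope to `W^(k+2)`. The loss factor tends to 1 as `k` grows, so a
large `k` leaves room below the extra speed. -/
lemma le_sum_load_queue {I : Instance m} {Q : Queues m} (hQ : Valid I Q) (k : ℕ) {s : ℝ}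
    (hs : 0 ≤ s) (i : Fin m) : s * ((k + 1) / (k + 2)) * totalWeight I (Q i) ≤
      ∑ j ∈ (Q i).toFinset,
        (weightAhead I (Q i) j + I.weight j) * share I k s (Q i) j := by
  by_cases hne : Q i = []
  · simp [hne]
  obtain ⟨j₀, hj₀⟩ := List.exists_mem_of_ne_nil _ hne
  have hT := hQ.totalWeight_pos hj₀
  have htel := sum_map_weightAhead_sub I (fun x => x ^ (k + 2)) (hQ.nodup i)
  rw [← List.sum_toFinset _ (hQ.nodup i)] at htel
  set W := totalWeight I (Q i)
  have hterm : ∀ j ∈ (Q i).toFinset, s * ((k + 1) / (k + 2)) / W ^ (k + 1) *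
      ((weightAhead I (Q i) j + I.weight j) ^ (k + 2) - weightAhead I (Q i) j ^ (k + 2)) ≤
      (weightAhead I (Q i) j + I.weight j) * share I k s (Q i) j := by
    intro j hj
    rw [List.mem_toFinset] at hj
    have hV := weightAhead_nonneg (hQ.weight_nonneg i) j
    have hw := hQ.weight_nonneg i j hj
    rw [share]
    set V := weightAhead I (Q i) j
    set w := I.weight j
    have h1 := mul_pow_le_pow_add (add_nonneg hV hw) hV (k + 1)
    push_cast at h1
    have h2 : ((k : ℝ) + 1) / (k + 2) * ((V + w) ^ (k + 2) - V ^ (k + 2)) ≤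
        (V + w) * ((V + w) ^ (k + 1) - V ^ (k + 1)) := by
      rw [div_mul_eq_mul_div, div_le_iff₀ (by positivity)]
      have e1 : (V + w) ^ (k + 2) = (V + w) * (V + w) ^ (k + 1) := by ring
      have e2 : (V + w) ^ (k + 1 + 1) = (V + w) * (V + w) ^ (k + 1) := by ring
      have e3 : V ^ (k + 1 + 1) = V ^ (k + 2) := by ring
      rw [e2, e3] at h1
      rw [e1]
      linarith
    calc s * ((k + 1) / (k + 2)) / W ^ (k + 1) * ((V + w) ^ (k + 2) - V ^ (k + 2))
        = s / W ^ (k + 1) * (((k : ℝ) + 1) / (k + 2) * ((V + w) ^ (k + 2) - V ^ (k + 2))) := by ring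
      _ ≤ s / W ^ (k + 1) * ((V + w) * ((V + w) ^ (k + 1) - V ^ (k + 1))) := by gcongr
      _ = _ := by ring
  refine le_trans (le_of_eq ?_) (Finset.sum_le_sum hterm)
  rw [← Finset.mul_sum, htel]
  have : W ^ (k + 2) = W * W ^ (k + 1) := by ring
  rw [this, zero_pow (by omega), sub_zero]
  field_simp

lemma le_sum_load {I : Instance m} {Q : Queues m} (hQ : Valid I Q) (k : ℕ) {s : ℝ} (hs : 0 ≤ s) :
    s * ((k + 1) / (k + 2)) * ∑ i, totalWeight I (Q i) ≤ ∑ j ∈ I.jobs, load I k s Q j := by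
  classical
  simp only [load]
  rw [Finset.sum_comm, Finset.mul_sum]
  refine Finset.sum_le_sum fun i _ => (le_sum_load_queue hQ k hs i).trans (le_of_eq ?_)
  rw [← Finset.sum_filter]
  refine Finset.sum_congr ?_ fun _ _ => rfl
  ext j
  simp only [List.mem_toFinset, Finset.mem_filter]
  exact ⟨fun h => ⟨hQ.mem_jobs i j h, h⟩, fun h => h.2⟩


namespace IsSettledRun

variable {k : ℕ} {s θ : ℝ} {I : Instance m} {S : Schedule m} {Q : ℝ → Queues m}

/-! ### The virtual utility of a job over time -/

lemma improves (h : IsSettledRun k s θ I S Q) (hm : 0 < m) (hs : 0 ≤ s) (hθ : 0 ≤ θ) {j : ℕ}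
    {a b : ℝ} (hab : a ≤ b) (hb : Active I S j b) :
    Improves I θ j (Q a) (Q b) := by
  refine rel_of_eventually Q (Improves I θ j) (Improves.refl I θ j)
    (fun _ _ _ h h' => h.trans hθ h') hab (fun t _ _ => ?_) fun t hat htb => ?_
  · filter_upwards [h.right t] with u hu
    rw [hu]
    exact Improves.refl I θ j _
  · obtain ⟨Q₀, h1, hv, -, h2⟩ := h.left' t
    filter_upwards [h1] with u hu
    -- A job active at `b` cannot depart earlier, because completion persists.
    have hnd : ¬ Done I S j t := fun hd => hb.2.2 ((h.feasible hs).done_mono hb.1 htb hd)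
    have hd := hv.of_sublist (depart_sublist I S t Q₀)
    rw [hu, h2]
    exact (improves_of_sublist hv (depart_sublist I S t Q₀)
      fun i hi => mem_depart.2 ⟨hi, hnd⟩).trans hθ
      (improves_of_reflTransGen hθ (isOutcome_settle hm hd).1 hd j)

lemma active_of_le (h : IsSettledRun k s θ I S Q) (hs : 0 ≤ s) {j : ℕ} {a b : ℝ} (hab : a ≤ b)
    (ha : I.release j ≤ a) (hb : Active I S j b) : Active I S j a :=
  ⟨hb.1, ha, fun hd => hb.2.2 ((h.feasible hs).done_mono hb.1 hab hd)⟩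

lemma utility_mono (h : IsSettledRun k s θ I S Q) (hm : 0 < m) (hs : 0 ≤ s) (hθ : 0 ≤ θ) {j : ℕ}
    {a b : ℝ} (hab : a ≤ b) (ha : I.release j ≤ a) (hb : Active I S j b) :
    utility I (Q a) (S.mach j a) j ≤ utility I (Q b) (S.mach j b) j ∧
    (S.mach j a ≠ S.mach j b →
      utility I (Q a) (S.mach j a) j < utility I (Q b) (S.mach j b) j ∧
      (1 + θ) * utility I (Q a) (S.mach j a) j ≤ utility I (Q b) (S.mach j b) j) := by
  have hma := (h.mem_iff a _ j).2 ⟨h.active_of_le hs hab ha hb, rfl⟩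
  obtain ⟨i, hi, h1⟩ := h.improves hm hs hθ hab hb _ hma
  rw [((h.mem_iff b i j).1 hi).2]
  exact h1

lemma utilityBound (h : IsSettledRun k s θ I S Q) (hm : 0 < m) (t : ℝ) :
    UtilityBound I (Q t) := by
  have ha : min t (-1) < 0 := (min_le_right _ _).trans_lt (by norm_num)
  refine rel_of_eventually Q (fun P R => UtilityBound I P → UtilityBound I R) (fun _ h => h)
    (fun _ _ _ h h' => h' ∘ h) (min_le_left t (-1)) (fun u _ _ => ?_) (fun u _ _ => ?_) ?_
  · filter_upwards [h.right u] with v hv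
    rw [hv]; exact id
  · obtain ⟨Q₀, h1, hv, -, h2⟩ := h.left' u
    filter_upwards [h1] with v hv' hb
    rw [hv'] at hb
    have hd := hv.of_sublist (depart_sublist I S u Q₀)
    rw [h2]
    exact utilityBound_of_reflTransGen (isOutcome_settle hm hd).1 hd
      (hb.of_sublist hv (depart_sublist I S u Q₀))
  · rw [h.eq_empty ha]
    intro i j hj
    simp at hj

/-- For another machine this is the equilibrium condition; on its own machine, standing behind the
whole queue is no better than its current place. -/
lemma joinUtility_le (h : IsSettledRun k s θ I S Q) (hθ : 0 ≤ θ) {j : ℕ} {t : ℝ}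
    (ht : Active I S j t) (i : Fin m) :
    joinUtility I (Q t) i j ≤ (1 + θ) * utility I (Q t) (S.mach j t) j := by
  have hv := h.valid t
  have hmem := (h.mem_iff t _ j).2 ⟨ht, rfl⟩
  have hu := utility_nonneg hv hmem
  have hle : utility I (Q t) (S.mach j t) j ≤ (1 + θ) * utility I (Q t) (S.mach j t) j := by
    nlinarith
  by_cases hi : i = S.mach j t
  · refine le_trans ?_ hle
    rw [hi]
    have hw := I.weight_pos j ht.1
    have h1 := weightAhead_nonneg (hv.weight_nonneg (S.mach j t)) j
    have h2 := weightAhead_add_le (hv.weight_nonneg (S.mach j t)) hmem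
    exact div_le_div_of_nonneg_left (I.rate_nonneg _ j ht.1) (by linarith) (by linarith)
  · by_contra! hlt
    exact h.nash t j _ i ⟨hmem, hi, hle.trans_lt hlt, hlt.le⟩

/-! ### The dual solution -/

/-- An active job is processed fast at all later times, compared with what it could get at time
`t` at the tail of any other queue. -/
lemma rate_mul_load_le (h : IsSettledRun k s θ I S Q) (hm : 0 < m) (hs : 0 ≤ s) (hθ : 0 ≤ θ)
    {j : ℕ} (hj : j ∈ I.jobs) {t t' : ℝ} (ht : I.release j ≤ t) (htt : t ≤ t') (i : Fin m) :
    I.rate i j * load I k s (Q t') j ≤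
      (1 + θ) * (totalWeight I (Q t i) + I.weight j) * speed I k s (Q t') j := by
  have hv := h.valid t'
  by_cases ha : Active I S j t'
  · have hmem := (h.mem_iff t' _ j).2 ⟨ha, rfl⟩
    -- Equilibrium at the earlier time `t`, then monotonicity of the utility up to `t'`. Clearing
    -- denominators and multiplying by the share turns utilities into load and speed.
    have h1 := (h.joinUtility_le hθ (h.active_of_le hs htt ht ha) i).trans
      (mul_le_mul_of_nonneg_left (h.utility_mono hm hs hθ htt ht ha).1 (by linarith))
    have hw := I.weight_pos j hj
    have hV := weightAhead_nonneg (hv.weight_nonneg (S.mach j t')) j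
    have hW := totalWeight_nonneg ((h.valid t).weight_nonneg i)
    rw [load_eq hv k s hmem, speed_eq hv k s hmem]
    have hsh := share_nonneg hv k hs hmem
    rw [joinUtility, utility, ← mul_div_assoc, div_le_div_iff₀ (by linarith) (by linarith)] at h1
    have h2 := mul_le_mul_of_nonneg_right h1 hsh
    linarith
  · have hn : ∀ i, j ∉ Q t' i := fun i hi => ha ((h.mem_iff t' i j).1 hi).1
    rw [load_eq_zero I k s hn, speed_eq_zero I k s hn]
    simp

lemma rate_mul_power (h : IsSettledRun k s θ I S Q) (j : ℕ) (t : ℝ) :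
    I.rate (S.mach j t) j * S.power j t = speed I k s (Q t) j := by
  by_cases ha : Active I S j t
  · have hmem := (h.mem_iff t _ j).2 ⟨ha, rfl⟩
    rw [speed_eq (h.valid t) k s hmem, h.power t _ j hmem]
  · rw [speed_eq_zero I k s fun i hi => ha ((h.mem_iff t i j).1 hi).1, h.power_zero t j ha,
      mul_zero]

lemma intervalIntegrable_speed (h : IsSettledRun k s θ I S Q) (hs : 0 ≤ s) (j : ℕ) (a b : ℝ) :
    IntervalIntegrable (fun u => speed I k s (Q u) j) MeasureTheory.volume a b :=
  UnrelatedMachines.intervalIntegrable_speed hs h.right h.valid j a b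

lemma intervalIntegrable_load (h : IsSettledRun k s θ I S Q) (hs : 0 ≤ s) {j : ℕ}
    (hj : j ∈ I.jobs) (a b : ℝ) :
    IntervalIntegrable (fun u => load I k s (Q u) j) MeasureTheory.volume a b := by
  refine intervalIntegrable_of_bounded
    (measurable_comp_of_eventually_eq (fun Q => load I k s Q j) h.right)
    (s * (k + 1) * I.weight j) (fun t => ?_) a b
  rw [abs_of_nonneg (load_nonneg (h.valid t) k hs j)]
  exact load_le (h.valid t) k hs hj

/-- No more work than its length is done on a job. -/
lemma integral_speed_le (h : IsSettledRun k s θ I S Q) (hs : 0 ≤ s) {j : ℕ} (hj : j ∈ I.jobs)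
    {t T : ℝ} (ht : I.release j ≤ t) (htT : t ≤ T) :
    ∫ u in t..T, speed I k s (Q u) j ≤ I.size j := by
  have hi := h.intervalIntegrable_speed hs j
  have h0 : ∀ u, 0 ≤ speed I k s (Q u) j := fun u => speed_nonneg (h.valid u) k hs j
  have h1 : ∫ u in (I.release j)..T, speed I k s (Q u) j ≤ I.size j := by
    refine integral_ite_lt_le (ht.trans htT) (I.size_pos j hj).le h0 hi hi (fun _ => le_rfl) ?_
    intro u hu hle
    refine speed_eq_zero I k s fun i hi => ((h.mem_iff u i j).1 hi).1.2.2 ⟨hu, ?_⟩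
    simpa only [work, h.rate_mul_power] using hle
  exact (intervalIntegral.integral_mono_interval ht htT le_rfl (.of_forall h0) (hi _ _)).trans h1

lemma integral_load_le (h : IsSettledRun k s θ I S Q) (hs : 0 ≤ s) {j : ℕ} (hj : j ∈ I.jobs)
    {a b : ℝ} (hab : a ≤ b) :
    ∫ u in a..b, load I k s (Q u) j ≤ s * (k + 1) * I.weight j * (b - a) := by
  have := intervalIntegral.integral_mono hab (h.intervalIntegrable_load hs hj a b)
    (intervalIntegrable_const (c := s * (k + 1) * I.weight j))
    fun u => load_le (h.valid u) k hs hj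
  rwa [intervalIntegral.integral_const, smul_eq_mul, mul_comm (b - a)] at this

/-- The load integral is split at `t`. Before `t` it is at most `s(k+1)w` per unit of time, giving
the term `w(t - r)`; after `t` it is controlled by the work still done on the job, at most its
length. The variables are cut off at a horizon `T`, since completion of the jobs is not yet known;
for `t > T` the first bound alone suffices. -/
lemma dual_constraint (h : IsSettledRun k s θ I S Q) (hm : 0 < m) (hs : 0 < s) (hθ : 0 ≤ θ)
    (hθs : 1 + θ ≤ s) {j : ℕ} (hj : j ∈ I.jobs) {t T : ℝ} (ht : I.release j ≤ t)
    (hT : I.release j ≤ T) (i : Fin m) :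
    (∫ u in (I.release j)..T, load I k s (Q u) j) / (s * (k + 1)) * I.rate i j ≤
      I.weight j * (t - I.release j) * I.rate i j +
        ((if t ≤ T then (1 + θ) / (s * (k + 1)) * totalWeight I (Q t i) else 0) + I.weight j) *
          I.size j := by
  have hw := I.weight_pos j hj
  have hp := I.size_pos j hj
  have hℓ := I.rate_nonneg i j hj
  have hsk : 0 < s * (k + 1) := by positivity
  have hi := h.intervalIntegrable_load hs.le hj
  split_ifs with htT
  · have hW := totalWeight_nonneg ((h.valid t).weight_nonneg i)
    have h1 := h.integral_load_le hs.le hj ht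
    have h2 : I.rate i j * ∫ u in t..T, load I k s (Q u) j ≤
        (1 + θ) * (totalWeight I (Q t i) + I.weight j) * I.size j := by
      refine le_trans ?_ (mul_le_mul_of_nonneg_left (h.integral_speed_le hs.le hj ht htT)
        (by positivity))
      rw [← intervalIntegral.integral_const_mul, ← intervalIntegral.integral_const_mul]
      exact intervalIntegral.integral_mono_on htT ((hi t T).const_mul _)
        ((h.intervalIntegrable_speed hs.le j t T).const_mul _)
        fun u hu => h.rate_mul_load_le hm hs.le hθ hj ht hu.1 i
    -- This absorbs the job's own weight at the tail of the queue into the separate term `w` of the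
    -- constraint.
    have h3 : (1 + θ) / (s * (k + 1)) ≤ 1 := by
      rw [div_le_one hsk]
      nlinarith [Nat.cast_nonneg (α := ℝ) k]
    rw [← intervalIntegral.integral_add_adjacent_intervals (hi _ t) (hi t T), div_mul_eq_mul_div,
      div_le_iff₀ hsk]
    have h4 := mul_le_mul_of_nonneg_right h1 hℓ
    have h5 : (1 + θ) * I.weight j * I.size j ≤ s * (k + 1) * (I.weight j * I.size j) := by
      rw [div_le_one hsk] at h3
      have := mul_le_mul_of_nonneg_right h3 (mul_pos hw hp).le
      linarith
    have h6 : (1 + θ) / (s * (k + 1)) * totalWeight I (Q t i) * (s * (k + 1)) =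
        (1 + θ) * totalWeight I (Q t i) := by field_simp
    calc _ ≤ s * (k + 1) * I.weight j * (t - I.release j) * I.rate i j +
          (1 + θ) * (totalWeight I (Q t i) + I.weight j) * I.size j := by linarith
      _ ≤ s * (k + 1) * I.weight j * (t - I.release j) * I.rate i j +
          ((1 + θ) * totalWeight I (Q t i)) * I.size j +
            s * (k + 1) * (I.weight j * I.size j) := by linarith
      _ = _ := by rw [← h6]; ring
  · have h1 := h.integral_load_le hs.le hj hT
    rw [not_le] at htT
    have h2 : (∫ u in (I.release j)..T, load I k s (Q u) j) / (s * (k + 1)) ≤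
        I.weight j * (t - I.release j) := by
      rw [div_le_iff₀ hsk]
      nlinarith [mul_pos hsk hw]
    have h3 := mul_le_mul_of_nonneg_right h2 hℓ
    nlinarith [mul_pos hw hp]

lemma totalWeight_le (h : IsSettledRun k s θ I S Q) (i : Fin m) (t : ℝ) :
    totalWeight I (Q t i) ≤ ∑ j ∈ I.jobs, I.weight j := by
  have hv := h.valid t
  rw [totalWeight_eq_sum I (hv.nodup i)]
  exact Finset.sum_le_sum_of_subset_of_nonneg (fun j hj => hv.mem_jobs i j (by simpa using hj))
    fun j hj _ => (I.weight_pos j hj).le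

lemma intervalIntegrable_totalWeight (h : IsSettledRun k s θ I S Q) (i : Fin m) (a b : ℝ) :
    IntervalIntegrable (fun u => totalWeight I (Q u i)) MeasureTheory.volume a b := by
  refine intervalIntegrable_of_bounded
    (measurable_comp_of_eventually_eq (fun Q => totalWeight I (Q i)) h.right)
    (∑ j ∈ I.jobs, I.weight j) (fun t => ?_) a b
  rw [abs_of_nonneg (totalWeight_nonneg ((h.valid t).weight_nonneg i))]
  exact h.totalWeight_le i t

lemma integral_load_eq (h : IsSettledRun k s θ I S Q) (hs : 0 ≤ s) {j : ℕ}
    (hj : j ∈ I.jobs) (T : ℝ) :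
    ∫ u in (0 : ℝ)..T, load I k s (Q u) j = ∫ u in (I.release j)..T, load I k s (Q u) j := by
  have hi := h.intervalIntegrable_load hs hj
  rw [← intervalIntegral.integral_add_adjacent_intervals (hi 0 (I.release j)) (hi _ T),
    intervalIntegral.integral_congr_Ioo_of_le (g := fun _ => 0) (I.release_nonneg j hj)
      fun u hu => load_eq_zero I k s fun i hi =>
        absurd ((h.mem_iff u i j).1 hi).1.2.1 (not_le.2 hu.2)]
  simp

/-- The total weight in the queues over time, compared with an arbitrary schedule. -/
lemma integral_totalWeight_le (h : IsSettledRun k s θ I S Q) (hm : 0 < m) (hs : 0 < s)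
    (hθ : 0 ≤ θ) (hθs : 1 + θ ≤ s) {P : Schedule m} (hP : Feasible 1 I P) {D : ℕ → ℝ}
    (hD : ∀ j ∈ I.jobs, Done I P j (D j)) {T : ℝ} (hT0 : 0 ≤ T)
    (hT : ∀ j ∈ I.jobs, I.release j ≤ T) :
    (s * ((k + 1) / (k + 2)) - (1 + θ)) / (s * (k + 1)) *
      ∫ u in (0 : ℝ)..T, ∑ i, totalWeight I (Q u i) ≤
      2 * ∑ j ∈ I.jobs, I.weight j * (D j - I.release j) := by
  have hsk : 0 < s * (k + 1) := by positivity
  set β : Fin m → ℝ → ℝ :=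
    fun i t => if t ≤ T then (1 + θ) / (s * (k + 1)) * totalWeight I (Q t i) else 0 with hβ
  have hW0 : ∀ i t, 0 ≤ totalWeight I (Q t i) :=
    fun i t => totalWeight_nonneg ((h.valid t).weight_nonneg i)
  have hc0 : 0 ≤ (1 + θ) / (s * (k + 1)) := by positivity
  have hmeas : ∀ i, Measurable fun t => totalWeight I (Q t i) :=
    fun i => measurable_comp_of_eventually_eq (fun Q => totalWeight I (Q i)) h.right
  have hβm : ∀ i, Measurable (β i) := fun i =>
    Measurable.ite measurableSet_Iic ((hmeas i).const_mul _) measurable_const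
  have hwn : 0 ≤ ∑ j ∈ I.jobs, I.weight j :=
    Finset.sum_nonneg fun j hj => (I.weight_pos j hj).le
  -- Weak duality needs a horizon beyond all completions of the compared schedule; the machine duals
  -- vanish between `T` and `T'`.
  obtain ⟨T', hT', hDT'⟩ : ∃ T', T ≤ T' ∧ ∀ j ∈ I.jobs, D j ≤ T' := by
    obtain ⟨M, hM⟩ := (I.jobs.image D).bddAbove
    exact ⟨max T M, le_max_left _ _, fun j hj =>
      (hM (Finset.mem_coe.2 (Finset.mem_image_of_mem D hj))).trans (le_max_right _ _)⟩
  have hdual := hP.weak_duality hD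
    (α := fun j => (∫ u in (I.release j)..T, load I k s (Q u) j) / (s * (k + 1))) (β := β) hβm
    (fun i t => by
      simp only [hβ]
      split_ifs
      · exact mul_nonneg hc0 (hW0 i t)
      · exact le_rfl)
    (B := (1 + θ) / (s * (k + 1)) * ∑ j ∈ I.jobs, I.weight j)
    (fun i t => by
      simp only [hβ]
      split_ifs
      · exact mul_le_mul_of_nonneg_left (h.totalWeight_le i t) hc0
      · positivity)
    (fun j hj t ht i => h.dual_constraint hm hs hθ hθs hj ht (hT j hj) i)
    (hT0.trans hT') hDT'
  have hWi : ∀ a b, IntervalIntegrable (fun u => ∑ i, totalWeight I (Q u i))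
      MeasureTheory.volume a b := fun a b => by
    simpa only [Finset.sum_fn] using IntervalIntegrable.sum Finset.univ
      fun i _ => h.intervalIntegrable_totalWeight i a b
  have hβint : ∫ u in (0 : ℝ)..T', ∑ i, β i u =
      (1 + θ) / (s * (k + 1)) * ∫ u in (0 : ℝ)..T, ∑ i, totalWeight I (Q u i) := by
    have e1 : Set.EqOn (fun u => ∑ i, β i u)
        (fun u => (1 + θ) / (s * (k + 1)) * ∑ i, totalWeight I (Q u i)) (Set.Ioo 0 T) := by
      intro u hu
      simp only [hβ, hu.2.le, if_true, Finset.mul_sum]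
    have e2 : Set.EqOn (fun u => ∑ i, β i u) (fun _ => 0) (Set.Ioo T T') := by
      intro u hu
      simp only [hβ, not_le.2 hu.1, if_false, Finset.sum_const_zero]
    have hβi : ∀ a b, IntervalIntegrable (fun u => ∑ i, β i u) MeasureTheory.volume a b := by
      intro a b
      refine intervalIntegrable_of_bounded (Finset.measurable_sum _ fun i _ => hβm i)
        (∑ _ : Fin m, (1 + θ) / (s * (k + 1)) * ∑ j ∈ I.jobs, I.weight j) (fun t => ?_) a b
      refine (Finset.abs_sum_le_sum_abs _ _).trans (Finset.sum_le_sum fun i _ => ?_)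
      simp only [hβ]
      split_ifs
      · rw [abs_of_nonneg (mul_nonneg hc0 (hW0 i t))]
        exact mul_le_mul_of_nonneg_left (h.totalWeight_le i t) hc0
      · rw [abs_zero]; positivity
    rw [← intervalIntegral.integral_add_adjacent_intervals (hβi 0 T) (hβi T T'),
      intervalIntegral.integral_congr_Ioo_of_le hT0 e1,
      intervalIntegral.integral_congr_Ioo_of_le hT' e2, intervalIntegral.integral_const_mul]
    simp
  -- The lower bound on the sum of the loads, integrated over time.
  have hα : s * ((k + 1) / (k + 2)) / (s * (k + 1)) *
      ∫ u in (0 : ℝ)..T, ∑ i, totalWeight I (Q u i) ≤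
      ∑ j ∈ I.jobs, (∫ u in (I.release j)..T, load I k s (Q u) j) / (s * (k + 1)) := by
    rw [← Finset.sum_div, div_mul_eq_mul_div]
    refine div_le_div_of_nonneg_right ?_ hsk.le
    rw [Finset.sum_congr rfl fun j hj => (h.integral_load_eq hs.le hj T).symm,
      ← intervalIntegral.integral_finsetSum fun j hj => h.intervalIntegrable_load hs.le hj 0 T,
      ← intervalIntegral.integral_const_mul]
    refine intervalIntegral.integral_mono hT0 ((hWi 0 T).const_mul _) ?_ fun u =>
      le_sum_load (h.valid u) k hs.le
    simpa only [Finset.sum_fn] using IntervalIntegrable.sum I.jobs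
      fun j hj => h.intervalIntegrable_load hs.le hj 0 T
  rw [hβint] at hdual
  rw [sub_div, sub_mul]
  linarith

/-! ### Flow-times -/

open Classical in
/-- The indicator of the presence of a job in the queues. -/
noncomputable def _root_.UnrelatedMachines.presence (Q : Queues m) (j : ℕ) : ℝ :=
  if ∃ i, j ∈ Q i then 1 else 0

lemma presence_eq_one (h : IsSettledRun k s θ I S Q) {j : ℕ} {t : ℝ} (ha : Active I S j t) :
    presence (Q t) j = 1 :=
  if_pos ⟨_, (h.mem_iff t _ j).2 ⟨ha, rfl⟩⟩

lemma _root_.UnrelatedMachines.presence_nonneg (Q : Queues m) (j : ℕ) : 0 ≤ presence Q j := by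
  unfold presence; split_ifs <;> norm_num

lemma intervalIntegrable_presence (h : IsSettledRun k s θ I S Q) (j : ℕ) (a b : ℝ) :
    IntervalIntegrable (fun u => presence (Q u) j) MeasureTheory.volume a b := by
  refine intervalIntegrable_of_bounded
    (measurable_comp_of_eventually_eq (fun Q => presence Q j) h.right) 1 (fun t => ?_) a b
  unfold presence; split_ifs <;> norm_num

lemma _root_.UnrelatedMachines.sum_weight_mul_presence {I : Instance m} {Q : Queues m}
    (hQ : Valid I Q) :
    ∑ j ∈ I.jobs, I.weight j * presence Q j = ∑ i, totalWeight I (Q i) := by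
  classical
  have h1 : ∀ i, totalWeight I (Q i) = ∑ j ∈ I.jobs, if j ∈ Q i then I.weight j else 0 := by
    intro i
    rw [totalWeight_eq_sum I (hQ.nodup i), ← Finset.sum_filter]
    refine Finset.sum_congr ?_ fun _ _ => rfl
    ext j
    simp only [List.mem_toFinset, Finset.mem_filter]
    exact ⟨fun h => ⟨hQ.mem_jobs i j h, h⟩, fun h => h.2⟩
  simp only [h1]
  rw [Finset.sum_comm]
  refine Finset.sum_congr rfl fun j _ => ?_
  unfold presence
  split_ifs with hj
  · obtain ⟨i, hi⟩ := hj
    rw [Finset.sum_eq_single i]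
    · simp [hi]
    · intro i' _ hne
      rw [if_neg fun h => hne (hQ.disjoint _ _ _ h hi)]
    · simp
  · push Not at hj
    simp [hj]

/-- A job unfinished at `t` has been in the queues throughout the interval from its release to `t`.
-/
lemma sub_release_le (h : IsSettledRun k s θ I S Q) (hs : 0 ≤ s) {j : ℕ} (hj : j ∈ I.jobs)
    {t T : ℝ} (ht : I.release j ≤ t) (htT : t ≤ T) (hn : ¬ Done I S j t) :
    t - I.release j ≤ ∫ u in (0 : ℝ)..T, presence (Q u) j := by
  have hi := h.intervalIntegrable_presence j
  have h1 : ∫ u in (I.release j)..t, presence (Q u) j = t - I.release j := by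
    rw [intervalIntegral.integral_congr_Ioo_of_le (g := fun _ => 1) ht fun u hu =>
      h.presence_eq_one (h.active_of_le hs hu.2.le hu.1.le ⟨hj, ht, hn⟩)]
    simp
  rw [← h1]
  exact intervalIntegral.integral_mono_interval (I.release_nonneg j hj) ht htT
    (.of_forall fun u => presence_nonneg (Q u) j) (hi _ _)

/-- If the job were unfinished later than its total presence after release, its presence would
exceed that total. The slack `δ` is removed by a limit. -/
lemma flowTime_le (h : IsSettledRun k s θ I S Q) (hs : 0 ≤ s) {j : ℕ} (hj : j ∈ I.jobs) {T : ℝ}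
    (hd : Done I S j T) :
    flowTime I S j ≤ ENNReal.ofReal (∫ u in (0 : ℝ)..T, presence (Q u) j) := by
  set x := ∫ u in (0 : ℝ)..T, presence (Q u) j with hx
  have hT0 : 0 ≤ T := (I.release_nonneg j hj).trans hd.1
  have hx0 : 0 ≤ x := intervalIntegral.integral_nonneg_of_forall hT0
    fun u => presence_nonneg (Q u) j
  have key : ∀ δ : ℝ, 0 < δ → Done I S j (I.release j + (x + δ)) := by
    intro δ hδ
    rcases le_or_gt T (I.release j + (x + δ)) with hle | hlt
    · exact (h.feasible hs).done_mono hj hle hd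
    · by_contra hn
      have := h.sub_release_le hs hj (by linarith) hlt.le hn
      rw [← hx] at this
      linarith
  have hlim : Tendsto (fun δ : ℝ => ENNReal.ofReal (x + δ)) (𝓝[>] 0) (𝓝 (ENNReal.ofReal x)) := by
    have : Tendsto (fun δ : ℝ => ENNReal.ofReal (x + δ)) (𝓝 0) (𝓝 (ENNReal.ofReal (x + 0))) :=
      (ENNReal.continuous_ofReal.comp (continuous_const.add continuous_id)).tendsto 0
    rw [add_zero] at this
    exact this.mono_left nhdsWithin_le_nhds
  refine ge_of_tendsto hlim ?_
  filter_upwards [self_mem_nhdsWithin] with δ hδ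
  refine (iInf₂_le _ (key δ hδ)).trans (le_of_eq ?_)
  rw [add_sub_cancel_left]

/-- The bound on the integrated queue weight is uniform in the horizon. It first forces all jobs to
complete and then bounds the cost. -/
lemma cost_le_of_done (h : IsSettledRun k s θ I S Q) (hm : 0 < m) (hs : 0 < s) (hθ : 0 ≤ θ)
    (hθs : 1 + θ ≤ s) (hgap : 1 + θ < s * ((k + 1) / (k + 2))) {P : Schedule m}
    (hP : Feasible 1 I P) {D : ℕ → ℝ} (hD : ∀ j ∈ I.jobs, Done I P j (D j)) :
    cost I S ≤ ENNReal.ofReal (2 * (s * (k + 1) / (s * ((k + 1) / (k + 2)) - (1 + θ))) *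
      ∑ j ∈ I.jobs, I.weight j * (D j - I.release j)) := by
  set K := 2 * (s * (k + 1) / (s * ((k + 1) / (k + 2)) - (1 + θ))) *
      ∑ j ∈ I.jobs, I.weight j * (D j - I.release j) with hK
  have hsk : 0 < s * (k + 1) := by positivity
  have hgap' : 0 < s * ((k + 1) / (k + 2)) - (1 + θ) := by linarith
  have hDn : ∀ j ∈ I.jobs, 0 ≤ I.weight j * (D j - I.release j) := fun j hj =>
    mul_nonneg (I.weight_pos j hj).le (sub_nonneg.2 (hD j hj).1)
  have hK0 : 0 ≤ K := mul_nonneg (by positivity) (Finset.sum_nonneg hDn)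
  have hpi := fun j => h.intervalIntegrable_presence j
  have hbound : ∀ T, 0 ≤ T → (∀ j ∈ I.jobs, I.release j ≤ T) →
      ∑ j ∈ I.jobs, I.weight j * ∫ u in (0 : ℝ)..T, presence (Q u) j ≤ K := by
    intro T hT0 hT
    have h1 := h.integral_totalWeight_le hm hs hθ hθs hP hD hT0 hT
    have h2 : ∑ j ∈ I.jobs, I.weight j * ∫ u in (0 : ℝ)..T, presence (Q u) j =
        ∫ u in (0 : ℝ)..T, ∑ i, totalWeight I (Q u i) := by
      simp only [← sum_weight_mul_presence (h.valid _)]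
      rw [intervalIntegral.integral_finsetSum fun j _ => (hpi j 0 T).const_mul _]
      simp only [intervalIntegral.integral_const_mul]
    rw [h2, hK]
    rw [div_mul_eq_mul_div, div_le_iff₀ hsk] at h1
    rw [mul_div_assoc', div_mul_eq_mul_div, le_div_iff₀ hgap']
    linarith
  have hterm : ∀ j T, 0 ≤ T → 0 ≤ ∫ u in (0 : ℝ)..T, presence (Q u) j := fun j T hT =>
    intervalIntegral.integral_nonneg_of_forall hT fun u => presence_nonneg (Q u) j
  -- A job unfinished at this `T` would by itself contribute more than `K` to the integrated weight.
  obtain ⟨T, hT0, hT⟩ : ∃ T, 0 ≤ T ∧ ∀ j ∈ I.jobs, I.release j + K / I.weight j < T := by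
    obtain ⟨M, hM⟩ := (I.jobs.image fun j => I.release j + K / I.weight j).bddAbove
    refine ⟨max 0 (M + 1), le_max_left _ _, fun j hj => ?_⟩
    have := hM (Finset.mem_coe.2 (Finset.mem_image_of_mem _ hj))
    exact (lt_add_of_le_of_pos this one_pos).trans_le (le_max_right _ _)
  have hrT : ∀ j ∈ I.jobs, I.release j ≤ T := fun j hj => by
    have := div_nonneg hK0 (I.weight_pos j hj).le
    linarith [hT j hj]
  have hdone : ∀ j ∈ I.jobs, Done I S j T := by
    intro j hj
    by_contra hn
    have hw := I.weight_pos j hj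
    have h1 := h.sub_release_le hs.le hj (hrT j hj) le_rfl hn
    have h2 : I.weight j * ∫ u in (0 : ℝ)..T, presence (Q u) j ≤ K :=
      (Finset.single_le_sum (f := fun j => I.weight j * ∫ u in (0 : ℝ)..T, presence (Q u) j)
        (fun j hj => mul_nonneg (I.weight_pos j hj).le (hterm j T hT0)) hj).trans
        (hbound T hT0 hrT)
    have h3 : K / I.weight j < T - I.release j := by linarith [hT j hj]
    rw [div_lt_iff₀ hw] at h3
    have h4 := mul_le_mul_of_nonneg_left h1 hw.le
    linarith
  calc cost I S ≤ ∑ j ∈ I.jobs, ENNReal.ofReal (I.weight j) *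
        ENNReal.ofReal (∫ u in (0 : ℝ)..T, presence (Q u) j) :=
      Finset.sum_le_sum fun j hj => mul_le_mul_right (h.flowTime_le hs.le hj (hdone j hj)) _
    _ = ENNReal.ofReal (∑ j ∈ I.jobs, I.weight j * ∫ u in (0 : ℝ)..T, presence (Q u) j) := by
      rw [ENNReal.ofReal_sum_of_nonneg fun j hj =>
        mul_nonneg (I.weight_pos j hj).le (hterm j T hT0)]
      exact Finset.sum_congr rfl fun j hj => (ENNReal.ofReal_mul (I.weight_pos j hj).le).symm
    _ ≤ ENNReal.ofReal K := ENNReal.ofReal_le_ofReal (hbound T hT0 hrT)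

/-- Flow-times are infima over completion times, so `D` is taken within `δ` of the infimum and `δ`
tends to zero. A schedule of infinite cost is no obstacle because the factor is positive. -/
lemma cost_le_mul_cost (h : IsSettledRun k s θ I S Q) (hm : 0 < m) (hs : 0 < s) (hθ : 0 ≤ θ)
    (hθs : 1 + θ ≤ s) (hgap : 1 + θ < s * ((k + 1) / (k + 2))) {P : Schedule m}
    (hP : Feasible 1 I P) :
    cost I S ≤ ENNReal.ofReal (2 * (s * (k + 1) / (s * ((k + 1) / (k + 2)) - (1 + θ)))) *
      cost I P := by
  set κ := 2 * (s * (k + 1) / (s * ((k + 1) / (k + 2)) - (1 + θ)))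
  have hκ : 0 < κ := by
    have : 0 < s * ((k + 1) / (k + 2)) - (1 + θ) := by linarith
    positivity
  by_cases htop : cost I P = ⊤
  · rw [htop, ENNReal.mul_top (by simpa using hκ)]
    exact le_top
  have hfin : ∀ j ∈ I.jobs, flowTime I P j ≠ ⊤ := by
    intro j hj hj'
    refine htop (ENNReal.sum_eq_top.2 ⟨j, hj, ?_⟩)
    rw [hj', ENNReal.mul_top (by simpa using I.weight_pos j hj)]
  have hnear : ∀ δ : ℝ, 0 < δ → ∀ j ∈ I.jobs, ∃ D, Done I P j D ∧
      D - I.release j ≤ (flowTime I P j).toReal + δ := by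
    intro δ hδ j hj
    have hlt : flowTime I P j < flowTime I P j + ENNReal.ofReal δ :=
      ENNReal.lt_add_right (hfin j hj) (by simpa using hδ)
    obtain ⟨D, hlt⟩ := iInf_lt_iff.1 (show (⨅ (t : ℝ) (_ : Done I P j t),
      ENNReal.ofReal (t - I.release j)) < flowTime I P j + ENNReal.ofReal δ from hlt)
    obtain ⟨hD, hlt⟩ := iInf_lt_iff.1 hlt
    refine ⟨D, hD, ?_⟩
    rw [← ENNReal.ofReal_toReal (hfin j hj), ← ENNReal.ofReal_add ENNReal.toReal_nonneg hδ.le]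
      at hlt
    exact ((ENNReal.ofReal_lt_ofReal_iff (by positivity)).1 hlt).le
  have hstep : ∀ δ : ℝ, 0 < δ → cost I S ≤ ENNReal.ofReal
      (κ * ∑ j ∈ I.jobs, I.weight j * ((flowTime I P j).toReal + δ)) := by
    intro δ hδ
    choose! D hD hDle using hnear δ hδ
    refine (h.cost_le_of_done hm hs hθ hθs hgap hP hD).trans (ENNReal.ofReal_le_ofReal ?_)
    refine mul_le_mul_of_nonneg_left (Finset.sum_le_sum fun j hj => ?_) hκ.le
    exact mul_le_mul_of_nonneg_left (hDle j hj) (I.weight_pos j hj).le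
  have hcont : Continuous fun δ : ℝ => ENNReal.ofReal
      (κ * ∑ j ∈ I.jobs, I.weight j * ((flowTime I P j).toReal + δ)) :=
    ENNReal.continuous_ofReal.comp (by fun_prop)
  have hlim := ge_of_tendsto ((hcont.tendsto 0).mono_left nhdsWithin_le_nhds)
    (by filter_upwards [self_mem_nhdsWithin] with δ hδ using hstep δ hδ :
      ∀ᶠ δ in 𝓝[>] (0 : ℝ), cost I S ≤ _)
  refine hlim.trans (le_of_eq ?_)
  rw [ENNReal.ofReal_mul hκ.le, ENNReal.ofReal_sum_of_nonneg fun j hj =>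
    mul_nonneg (I.weight_pos j hj).le (by simp)]
  congr 1
  refine Finset.sum_congr rfl fun j hj => ?_
  rw [add_zero, ENNReal.ofReal_mul (I.weight_pos j hj).le, ENNReal.ofReal_toReal (hfin j hj)]

lemma cost_le_mul_opt (h : IsSettledRun k s θ I S Q) (hm : 0 < m) (hs : 0 < s) (hθ : 0 ≤ θ)
    (hθs : 1 + θ ≤ s) (hgap : 1 + θ < s * ((k + 1) / (k + 2))) {c : ℝ}
    (hc : 2 * (s * (k + 1) / (s * ((k + 1) / (k + 2)) - (1 + θ))) ≤ c) :
    cost I S ≤ ENNReal.ofReal c * opt I := by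
  have hc0 : 0 < c := by
    have : 0 < s * ((k + 1) / (k + 2)) - (1 + θ) := by linarith
    exact lt_of_lt_of_le (by positivity) hc
  rw [mul_comm, ← ENNReal.div_le_iff_le_mul (.inl (by simpa using hc0))
    (.inl ENNReal.ofReal_ne_top)]
  refine le_iInf₂ fun P hP => ?_
  rw [ENNReal.div_le_iff_le_mul (.inl (by simpa using hc0)) (.inl ENNReal.ofReal_ne_top), mul_comm]
  exact (h.cost_le_mul_cost hm hs hθ hθs hgap hP).trans
    (mul_le_mul_left (ENNReal.ofReal_le_ofReal hc) _)

end IsSettledRun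


/-! ### The number of migrations -/

namespace IsSettledRun

variable {k : ℕ} {s θ : ℝ} {I : Instance m} {S : Schedule m} {Q : ℝ → Queues m}

/-- Utilities at successive sampling times are monotone and gain a factor `1 + θ` at each change of
machine. The positivity claim uses the strict gain and excludes a job whose utility stays zero. -/
lemma pow_card_mul_utility_le (h : IsSettledRun k s θ I S Q) (hm : 0 < m) (hs : 0 ≤ s)
    (hθ : 0 ≤ θ) {j : ℕ} {τ : ℕ → ℝ} (hτ : Monotone τ) (N : ℕ)
    (ha : ∀ a ≤ N, Active I S j (τ a)) :
    (1 + θ) ^ ((Finset.range N).filter fun a => S.mach j (τ a) ≠ S.mach j (τ (a + 1))).card *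
        utility I (Q (τ 0)) (S.mach j (τ 0)) j ≤ utility I (Q (τ N)) (S.mach j (τ N)) j ∧
      (((Finset.range N).filter fun a => S.mach j (τ a) ≠ S.mach j (τ (a + 1))).card ≠ 0 →
        0 < utility I (Q (τ N)) (S.mach j (τ N)) j) := by
  induction N with
  | zero => simp
  | succ N ih =>
    obtain ⟨ih1, ih2⟩ := ih fun a haN => ha a (by omega)
    have hN := ha N (by omega)
    obtain ⟨hle, hlt⟩ := h.utility_mono hm hs hθ (hτ (Nat.le_succ N)) hN.2.1 (ha (N + 1) le_rfl)
    have h0 := utility_nonneg (h.valid (τ N)) ((h.mem_iff (τ N) _ j).2 ⟨hN, rfl⟩)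
    rw [Finset.range_add_one, Finset.filter_insert]
    split_ifs with hne
    · obtain ⟨hlt1, hlt2⟩ := hlt hne
      rw [Finset.card_insert_of_notMem (by simp)]
      refine ⟨?_, fun _ => h0.trans_lt hlt1⟩
      rw [pow_succ', mul_assoc]
      exact (mul_le_mul_of_nonneg_left ih1 (by linarith)).trans hlt2
    · exact ⟨ih1.trans hle, fun hc => (ih2 hc).trans_le hle⟩

end IsSettledRun

lemma one_le_weightRatio {I : Instance m} {j : ℕ} (hj : j ∈ I.jobs) : 1 ≤ weightRatio I := by
  have hne : I.jobs.Nonempty := ⟨j, hj⟩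
  rw [weightRatio, dif_pos hne, one_le_div₀]
  · exact (Finset.inf'_le _ hj).trans (Finset.le_sup' _ hj)
  · exact (Finset.lt_inf'_iff hne).2 fun a ha => I.weight_pos a ha

lemma sum_weight_le {I : Instance m} {j : ℕ} (hj : j ∈ I.jobs) :
    ∑ j' ∈ I.jobs, I.weight j' ≤ weightRatio I * I.jobs.card * I.weight j := by
  have hne : I.jobs.Nonempty := ⟨j, hj⟩
  have hmin : 0 < I.jobs.inf' hne I.weight :=
    (Finset.lt_inf'_iff hne).2 fun a ha => I.weight_pos a ha
  have h1 : ∑ j' ∈ I.jobs, I.weight j' ≤ I.jobs.card * I.jobs.sup' hne I.weight := by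
    rw [← nsmul_eq_mul]
    exact Finset.sum_le_card_nsmul _ _ _ fun a ha => Finset.le_sup' _ ha
  have h2 : I.jobs.sup' hne I.weight ≤ weightRatio I * I.weight j := by
    have h3 : I.jobs.sup' hne I.weight = weightRatio I * I.jobs.inf' hne I.weight := by
      rw [weightRatio, dif_pos hne, div_mul_cancel₀ _ hmin.ne']
    rw [h3]
    exact mul_le_mul_of_nonneg_left (Finset.inf'_le _ hj)
      (zero_le_one.trans (one_le_weightRatio hj))
  have h3 := mul_le_mul_of_nonneg_left h2 (Nat.cast_nonneg (α := ℝ) I.jobs.card)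
  linarith

/-- With `d` the final machine, the first utility is at least `ℓ_dj` over the weight of all jobs,
because `UtilityBound` covers every machine, and the last is at most `ℓ_dj / w_j`. The rate cancels
and the logarithm of the remaining weight ratio bounds the count. -/
lemma IsSettledRun.migratesAtMost {k : ℕ} {s θ : ℝ} {I : Instance m} {S : Schedule m}
    {Q : ℝ → Queues m} (h : IsSettledRun k s θ I S Q) (hm : 0 < m) (hs : 0 ≤ s) (hθ : 0 ≤ θ)
    {j : ℕ} (hj : j ∈ I.jobs) {c : ℝ} (hc : 0 ≤ c) (hcθ : 1 ≤ c * Real.log (1 + θ)) :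
    MigratesAtMost I S j (c * (Real.log (weightRatio I) + Real.log I.jobs.card)) := by
  intro N τ hτ ha
  obtain ⟨h1, h2⟩ := h.pow_card_mul_utility_le hm hs hθ hτ N ha
  set n := ((Finset.range N).filter fun a => S.mach j (τ a) ≠ S.mach j (τ (a + 1))).card
  have hr := one_le_weightRatio hj
  have hcard : (1 : ℝ) ≤ I.jobs.card := by
    exact_mod_cast Finset.card_pos.2 ⟨j, hj⟩
  have hL : 0 ≤ Real.log (weightRatio I) + Real.log I.jobs.card :=
    add_nonneg (Real.log_nonneg hr) (Real.log_nonneg hcard)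
  by_cases hn : n = 0
  · rw [hn, Nat.cast_zero]
    exact mul_nonneg hc hL
  have hpos := h2 hn
  have hw := I.weight_pos j hj
  set W := ∑ j' ∈ I.jobs, I.weight j' with hW
  have hWpos : 0 < W := Finset.sum_pos (fun a ha => I.weight_pos a ha) ⟨j, hj⟩
  set d := S.mach j (τ N)
  have hV := weightAhead_nonneg ((h.valid (τ N)).weight_nonneg d) j
  have hup : utility I (Q (τ N)) d j ≤ I.rate d j / I.weight j :=
    div_le_div_of_nonneg_left (I.rate_nonneg d j hj) hw (by linarith)
  -- After at least one migration the final utility is positive, so the rate may be cancelled.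
  have hrate : 0 < I.rate d j := by
    have := hpos.trans_le hup
    rwa [div_pos_iff_of_pos_right hw] at this
  have hlow := h.utilityBound hm (τ 0) _ j
    ((h.mem_iff (τ 0) _ j).2 ⟨ha 0 (Nat.zero_le _), rfl⟩) d
  rw [← hW] at hlow
  have h3 : (1 + θ) ^ n * (I.rate d j / W) ≤ I.rate d j / I.weight j :=
    (mul_le_mul_of_nonneg_left hlow (by positivity)).trans (h1.trans hup)
  have h4 : (1 + θ) ^ n ≤ weightRatio I * I.jobs.card := by
    rw [← mul_div_assoc, div_le_div_iff₀ hWpos hw] at h3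
    have h5 := mul_le_mul_of_nonneg_left (sum_weight_le hj) hrate.le
    have h6 : (1 + θ) ^ n * (I.rate d j * I.weight j) ≤
        weightRatio I * I.jobs.card * (I.rate d j * I.weight j) := by linarith
    exact le_of_mul_le_mul_right h6 (by positivity)
  have h5 := Real.log_le_log (by positivity) h4
  rw [Real.log_pow, Real.log_mul (by linarith) (by linarith)] at h5
  calc (n : ℝ) ≤ n * (c * Real.log (1 + θ)) := le_mul_of_one_le_right (Nat.cast_nonneg n) hcθ
    _ = c * (n * Real.log (1 + θ)) := by ring
    _ ≤ _ := mul_le_mul_of_nonneg_left h5 hc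

/-! ### The theorem -/

/-- SelfishMigrate as a non-clairvoyant algorithm. -/
lemma exists_algorithm (hm : 0 < m) (k : ℕ) {s θ : ℝ} (hs : 0 ≤ s) (hθ : 0 ≤ θ) :
    ∃ A : Instance m → Schedule m, IsNonClairvoyant s A ∧
      (∀ I, IsSelfishMigrate k s θ I (A I)) ∧ ∀ I, ∃ Q, IsSettledRun k s θ I (A I) Q := by
  choose A Q hA using fun I : Instance m => exists_isSettledRun hm I k hs hθ
  exact ⟨A, ⟨fun I => (hA I).feasible hs, fun I₁ I₂ t h j hj => (hA I₁).causal (hA I₂) h hj⟩,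
    fun I => (hA I).isSelfishMigrate hm, fun I => ⟨Q I, hA I⟩⟩

/-- Half of the extra speed survives the loss `(k+1)/(k+2)` as soon as `k ≥ 2/ε`. -/
lemma half_le_gap {ε k : ℝ} (hε : 0 < ε) (hk : 4 / ε ≤ k) :
    1 + ε / 2 ≤ (1 + ε) * ((k + 1) / (k + 2)) := by
  have hk0 : 0 < k := (by positivity : 0 < 4 / ε).trans_le hk
  rw [div_le_iff₀ hε] at hk
  rw [← mul_div_assoc, le_div_iff₀ (by linarith)]
  nlinarith

lemma ratio_le {ε θ k : ℝ} (hε : 0 < ε) (hθ : θ ≤ ε / 4) (hk : 4 / ε ≤ k)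
    (hk' : k ≤ 4 / ε + 1) :
    2 * ((1 + ε) * (k + 1) / ((1 + ε) * ((k + 1) / (k + 2)) - (1 + θ))) ≤
      56 * (1 + 1 / ε ^ 2) := by
  have hk0 : 0 < k := (by positivity : 0 < 4 / ε).trans_le hk
  have hgap := half_le_gap hε hk
  have h1 : (1 + ε) * (k + 1) / ((1 + ε) * ((k + 1) / (k + 2)) - (1 + θ)) ≤
      -- The denominator is at least `ε/2 - θ ≥ ε/4`.
      (1 + ε) * (4 / ε + 2) / (ε / 4) := by
    apply div_le_div₀
    · positivity
    · exact mul_le_mul_of_nonneg_left (by linarith) (by positivity)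
    · positivity
    · linarith
  -- The constant 56 lets the difference become a square plus a positive constant: the cross term
  -- `48/ε` is absorbed by `24 + 24/ε²`.
  have h2 : 56 * (1 + 1 / ε ^ 2) - 2 * ((1 + ε) * (4 / ε + 2) / (ε / 4)) =
      (24 * (1 / ε - 1) ^ 2 + 16) := by
    field_simp
    ring
  nlinarith [sq_nonneg (1 / ε - 1)]

lemma one_le_mul_log {ε : ℝ} (hε : 0 < ε) : 1 ≤ 56 * (1 + 1 / ε) * Real.log (1 + ε / 4) := by
  have h1 := Real.one_sub_inv_le_log_of_pos (by positivity : 0 < 1 + ε / 4)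
  refine le_trans ?_ (mul_le_mul_of_nonneg_left h1 (by positivity))
  have : 56 * (1 + 1 / ε) * (1 - (1 + ε / 4)⁻¹) = 56 * (1 + ε) / (4 + ε) := by
    field_simp
    ring
  rw [this, le_div_iff₀ (by positivity)]
  linarith

end UnrelatedMachines

theorem theorem1 :
    ∃ C : ℝ, 0 < C ∧ ∀ ε : ℝ, 0 < ε → ∃ (k : ℕ) (θ : ℝ), 0 < θ ∧ ∀ m : ℕ, 0 < m →
      (∃ A : UnrelatedMachines.Instance m → UnrelatedMachines.Schedule m,
        UnrelatedMachines.IsNonClairvoyant (1 + ε) A ∧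
        (∀ I, UnrelatedMachines.IsSelfishMigrate k (1 + ε) 0 I (A I)) ∧
        UnrelatedMachines.IsCompetitive (C * (1 + 1 / ε ^ 2)) A) ∧
      (∃ A : UnrelatedMachines.Instance m → UnrelatedMachines.Schedule m,
        UnrelatedMachines.IsNonClairvoyant (1 + ε) A ∧
        (∀ I, UnrelatedMachines.IsSelfishMigrate k (1 + ε) θ I (A I)) ∧
        UnrelatedMachines.IsCompetitive (C * (1 + 1 / ε ^ 2)) A ∧
        ∀ I : UnrelatedMachines.Instance m, ∀ j ∈ I.jobs,
          UnrelatedMachines.MigratesAtMost I (A I) j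
            (C * (1 + 1 / ε) * (Real.log (UnrelatedMachines.weightRatio I) +
              Real.log I.jobs.card))) := by
  -- The choice `θ = ε/4` takes half of the remaining gap `ε/2` and still has `log(1+θ)` large
  -- enough for the migration bound; `k = ⌈4/ε⌉` serves both algorithms.
  refine ⟨56, by norm_num, fun ε hε => ⟨⌈4 / ε⌉₊, ε / 4, by positivity, fun m hm => ?_⟩⟩
  have hk : 4 / ε ≤ (⌈4 / ε⌉₊ : ℝ) := Nat.le_ceil _
  have hk' : (⌈4 / ε⌉₊ : ℝ) ≤ 4 / ε + 1 := (Nat.ceil_lt_add_one (by positivity)).le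
  have hs : 0 < 1 + ε := by positivity
  have hgap := UnrelatedMachines.half_le_gap hε hk
  obtain ⟨A, hA, hA', hrun⟩ :=
    UnrelatedMachines.exists_algorithm hm ⌈4 / ε⌉₊ hs.le le_rfl
  obtain ⟨B, hB, hB', hrun'⟩ :=
    UnrelatedMachines.exists_algorithm hm ⌈4 / ε⌉₊ hs.le (by positivity : 0 ≤ ε / 4)
  refine ⟨⟨A, hA, hA', fun I => ?_⟩, ⟨B, hB, hB', fun I => ?_, fun I j hj => ?_⟩⟩
  · obtain ⟨Q, hQ⟩ := hrun I
    exact hQ.cost_le_mul_opt hm hs le_rfl (by linarith) (by linarith)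
      (UnrelatedMachines.ratio_le hε (by positivity) hk hk')
  · obtain ⟨Q, hQ⟩ := hrun' I
    exact hQ.cost_le_mul_opt hm hs (by positivity) (by linarith) (by linarith)
      (UnrelatedMachines.ratio_le hε le_rfl hk hk')
  · obtain ⟨Q, hQ⟩ := hrun' I
    exact hQ.migratesAtMost hm hs.le (by positivity) hj (by positivity)
      (UnrelatedMachines.one_le_mul_log hε)
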